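/- Call $\Omega\subseteq\mathbb{C}$ an annulus if $\Omega=\{z\in\mathbb{C}:|z|\in I\}$ for some interval $I\subseteq[0,\infty)$; then $I=\Omega\cap[0,\infty)$. Say that $\Omega$ is of pd-type if for every $z\in\Omega\setminus I$ there is $\epsilon>0$ with $|z|+\epsilon\in I$, and of psd-type if for every $z\in\Omega\setminus I$ there is $\delta>0$ with $|z|-\delta\in I$. For $f:\Omega\to\mathbb{C}$ and an $n\times n$ matrix $A=(a_{ij})$ with entries in $\Omega$ (written $A\in M_n(\Omega)$), let $f[A]=(f(a_{ij}))$. Theorem. Fix an integer $n\ge 3$, an annulus $\Omega\subseteq\mathbb{C}$ with $\Omega\neq\{0\}$, and a function $f:\Omega\to\mathbb{C}$. If $\Omega$ is of pd-type, then the following are equivalent: (1) For every Hermitian matrix $A\in M_n(\Omega)$, $A$ is positive definite if and only if $f[A]$ is positive definite. (2) There exists a real $\alpha>0$ such that either $f(z)=\alpha z$ for all $z\in\Omega$, or $f(z)=\alpha\overline{z}$ for all $z\in\Omega$. If $\Omega$ is of psd-type, then the same equivalence holds with "definite" replaced by "semidefinite" in (1). -/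

import Mathlib

open scoped ComplexOrder

/-- The set `I = Ω ∩ [0, ∞)`, as a set of real numbers. -/
def nonnegPart (Ω : Set ℂ) : Set ℝ :=
  {r : ℝ | 0 ≤ r ∧ (r : ℂ) ∈ Ω}

/-- An annulus (centred at the origin): a set `{z : |z| ∈ I}` for an interval `I ⊆ [0, ∞)`. -/
def IsAnnulus (Ω : Set ℂ) : Prop :=
  ∃ I : Set ℝ, I ⊆ Set.Ici 0 ∧ I.OrdConnected ∧ Ω = {z : ℂ | ‖z‖ ∈ I}

/-- `Ω` is of pd-type: for all `z ∈ Ω \ I` there is `ε > 0` with `|z| + ε ∈ I`,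
where `I = Ω ∩ [0, ∞)`. -/
def IsPdType (Ω : Set ℂ) : Prop :=
  ∀ z ∈ Ω \ (fun r : ℝ => (r : ℂ)) '' nonnegPart Ω, ∃ ε : ℝ, 0 < ε ∧ ‖z‖ + ε ∈ nonnegPart Ω

/-- `Ω` is of psd-type: for all `z ∈ Ω \ I` there is `δ > 0` with `|z| - δ ∈ I`,
where `I = Ω ∩ [0, ∞)`. -/
def IsPsdType (Ω : Set ℂ) : Prop :=
  ∀ z ∈ Ω \ (fun r : ℝ => (r : ℂ)) '' nonnegPart Ω, ∃ δ : ℝ, 0 < δ ∧ ‖z‖ - δ ∈ nonnegPart Ω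

/-- `f : Ω → ℂ` is a positive definite sign preserver on `M_n(Ω)`: a Hermitian matrix `A` with
entries in `Ω` is positive definite if and only if the entrywise image `f[A]` is. -/
def IsPdSignPreserver (n : ℕ) {Ω : Set ℂ} (f : Ω → ℂ) : Prop :=
  ∀ A : Matrix (Fin n) (Fin n) Ω, (A.map Subtype.val).IsHermitian →
    ((A.map Subtype.val).PosDef ↔ (A.map f).PosDef)

/-- `f : Ω → ℂ` is a positive semidefinite sign preserver on `M_n(Ω)`: a Hermitian matrix `A` with
entries in `Ω` is positive semidefinite if and only if the entrywise image `f[A]` is. -/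
def IsPsdSignPreserver (n : ℕ) {Ω : Set ℂ} (f : Ω → ℂ) : Prop :=
  ∀ A : Matrix (Fin n) (Fin n) Ω, (A.map Subtype.val).IsHermitian →
    ((A.map Subtype.val).PosSemidef ↔ (A.map f).PosSemidef)

/-! For a map of either linear form, a Hermitian `A` goes to a positive multiple of `A` or of its
transpose, so only the rigidity direction has content. There everything is tested on 3 × 3 matrices,
repeating the last row and column to reach size n; zero padding is not an option, since 0 need not
lie in Ω. For a positive corner entry, a Schur complement turns semidefiniteness into three scalar
inequalities (`SchurNonneg`), and special matrices encode special comparisons.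

On positive radii, f is real and strictly increasing. One family of matrices compares y with the
arithmetic mean of a and x, which makes f affine (`affine_of_midpoint_iff`); another compares c²
with a product, and a strict AM–GM inequality then removes the constant term. After dividing by α, f
fixes the radii. Equality cases of the Schur inequality give f(rs) = r F(s) for unimodular s, with F
multiplicative on the circle. A one-parameter family detects Re s near 1, so F is the identity or
conjugation (`circle_hom_eq_id_or_conj`), and so is f (`id_or_conj_of_schurNonneg_iff`).

The definite case reduces to the semidefinite one by adding small positive diagonals. This needs
strict monotonicity and right-continuity of f on the positive radii; the latter comes from
`pd_preserver_geometric`. -/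

open ComplexConjugate in
/-- The Hermitian `3 × 3` matrix with given real diagonal and given upper triangle. -/
def hermThree (a b c : ℝ) (x y z : ℂ) : Matrix (Fin 3) (Fin 3) ℂ :=
  !![(a : ℂ), x, y; conj x, (b : ℂ), z; conj y, conj z, (c : ℂ)]

open ComplexConjugate in
/-- The Schur complement conditions for positive semidefiniteness of `hermThree a b c x y z`. -/
def SchurNonneg (a b c : ℝ) (x y z : ℂ) : Prop :=
  Complex.normSq y ≤ a * c ∧ Complex.normSq z ≤ b * c ∧
    Complex.normSq (c * x - y * conj z) ≤
      (a * c - Complex.normSq y) * (b * c - Complex.normSq z)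

/-! ### Semidefiniteness of 3 × 3 Hermitian matrices -/

section HermThree

open ComplexConjugate

theorem hermThree_isHermitian (a b c : ℝ) (x y z : ℂ) : (hermThree a b c x y z).IsHermitian := by
  ext i j
  fin_cases i <;> fin_cases j <;> simp [hermThree, Matrix.conjTranspose_apply]

theorem two_variable_form_nonneg_iff (p q : ℝ) (w : ℂ) :
    (∀ u v : ℂ, 0 ≤ p * Complex.normSq u + q * Complex.normSq v + 2 * (conj u * v * w).re) ↔
      0 ≤ p ∧ 0 ≤ q ∧ Complex.normSq w ≤ p * q := by
  constructor
  · intro h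
    have hp : 0 ≤ p := by simpa using h 1 0
    have hq : 0 ≤ q := by simpa using h 0 1
    -- The vector (-s, t · conj w) makes the cross term real and nonpositive for s, t ≥ 0. Taking s
    -- = |w|², t = p below gives p|w|²(pq - |w|²) ≥ 0.
    have key : ∀ s t : ℝ, 0 ≤ p * s ^ 2 + q * (t ^ 2 * Complex.normSq w)
        - 2 * s * t * Complex.normSq w := by
      intro s t
      have := h (-(s : ℂ)) (t * conj w)
      convert this using 1
      simp [Complex.normSq_apply]
      ring
    refine ⟨hp, hq, ?_⟩
    have hN := Complex.normSq_nonneg w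
    rcases hN.eq_or_lt with h0 | h0
    · rw [← h0]; positivity
    rcases hp.eq_or_lt with hp0 | hp0
    · have := key (q + 1) 1
      rw [← hp0] at this
      nlinarith [mul_nonneg hq hN]
    · have := key (Complex.normSq w) p
      have h2 : 0 ≤ (p * Complex.normSq w) * (p * q - Complex.normSq w) := by linarith
      have := (mul_nonneg_iff_of_pos_left (mul_pos hp0 h0)).1 h2
      linarith
  · rintro ⟨hp, hq, hw⟩ u v
    rcases hp.eq_or_lt with hp0 | hp0
    · have : w = 0 := by
        rw [← Complex.normSq_eq_zero]
        apply le_antisymm _ (Complex.normSq_nonneg w)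
        rw [← hp0] at hw; linarith
      rw [← hp0, this]
      simp only [zero_mul, mul_zero, Complex.zero_re, zero_add, add_zero]
      exact mul_nonneg hq (Complex.normSq_nonneg v)
    · have h1 : 0 ≤ Complex.normSq (p * u + v * w)
          + (p * q - Complex.normSq w) * Complex.normSq v :=
        add_nonneg (Complex.normSq_nonneg _)
          (mul_nonneg (by linarith) (Complex.normSq_nonneg _))
      have h2 : Complex.normSq (p * u + v * w) + (p * q - Complex.normSq w) * Complex.normSq v
          = p * (p * Complex.normSq u + q * Complex.normSq v + 2 * (conj u * v * w).re) := by
        simp [Complex.normSq_apply]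
        ring
      rw [h2] at h1
      exact (mul_nonneg_iff_of_pos_left hp0).1 h1

theorem hermThree_dotProduct (a b c : ℝ) (x y z : ℂ) (v : Fin 3 → ℂ) :
    star v ⬝ᵥ (hermThree a b c x y z).mulVec v =
      ((a * Complex.normSq (v 0) + b * Complex.normSq (v 1) + c * Complex.normSq (v 2)
        + 2 * (conj (v 0) * x * v 1 + conj (v 0) * y * v 2 + conj (v 1) * z * v 2).re : ℝ) : ℂ) := by
  apply Complex.ext
  · simp [hermThree, dotProduct, Matrix.mulVec, Fin.sum_univ_three, Complex.normSq_apply]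
    ring
  · simp [hermThree, dotProduct, Matrix.mulVec, Fin.sum_univ_three]
    ring

theorem hermThree_posSemidef_iff_form (a b c : ℝ) (x y z : ℂ) :
    (hermThree a b c x y z).PosSemidef ↔ ∀ v : Fin 3 → ℂ,
      0 ≤ a * Complex.normSq (v 0) + b * Complex.normSq (v 1) + c * Complex.normSq (v 2)
        + 2 * (conj (v 0) * x * v 1 + conj (v 0) * y * v 2 + conj (v 1) * z * v 2).re := by
  rw [Matrix.posSemidef_iff_dotProduct_mulVec]
  simp only [hermThree_isHermitian, true_and, hermThree_dotProduct, Complex.zero_le_real]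

/-- Complete the square in the third variable: c times the form is a squared modulus, which a choice
of that variable annihilates, plus a form in two variables. -/
theorem hermThree_posSemidef_iff {c : ℝ} (hc : 0 < c) (a b : ℝ) (x y z : ℂ) :
    (hermThree a b c x y z).PosSemidef ↔ SchurNonneg a b c x y z := by
  have hkey : (hermThree a b c x y z).PosSemidef ↔
      ∀ u v : ℂ, 0 ≤ (a * c - Complex.normSq y) * Complex.normSq u
        + (b * c - Complex.normSq z) * Complex.normSq v
        + 2 * (conj u * v * (c * x - y * conj z)).re := by
    rw [hermThree_posSemidef_iff_form]
    have hid : ∀ u v w : ℂ,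
        c * (a * Complex.normSq u + b * Complex.normSq v + c * Complex.normSq w
          + 2 * (conj u * x * v + conj u * y * w + conj v * z * w).re) =
        Complex.normSq (c * w + conj y * u + conj z * v) +
        ((a * c - Complex.normSq y) * Complex.normSq u
        + (b * c - Complex.normSq z) * Complex.normSq v
        + 2 * (conj u * v * (c * x - y * conj z)).re) := by
      intro u v w
      simp [Complex.normSq_apply]
      ring
    constructor
    · intro h u v
      have h1 := h ![u, v, -(conj y * u + conj z * v) / c]
      simp only [Matrix.cons_val] at h1
      have h2 := mul_nonneg hc.le h1
      rw [hid] at h2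
      have h3 : (c : ℂ) * (-(conj y * u + conj z * v) / c) + conj y * u + conj z * v = 0 := by
        have : (c : ℂ) ≠ 0 := by exact_mod_cast hc.ne'
        field_simp
        ring
      rw [h3, Complex.normSq_zero, zero_add] at h2
      exact h2
    · intro h v
      have h1 := hid (v 0) (v 1) (v 2)
      have h2 := add_nonneg
        (Complex.normSq_nonneg (c * v 2 + conj y * v 0 + conj z * v 1)) (h (v 0) (v 1))
      rw [← h1] at h2
      exact (mul_nonneg_iff_of_pos_left hc).1 h2
  rw [hkey, two_variable_form_nonneg_iff, sub_nonneg, sub_nonneg]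
  rfl

theorem hermThree_zero_posSemidef : (hermThree 0 0 0 0 0 0).PosSemidef := by
  rw [hermThree_posSemidef_iff_form]
  simp

theorem hermThree_diag_add_posSemidef {a b c a' b' c' : ℝ} {x y z : ℂ}
    (h : (hermThree a b c x y z).PosSemidef) (ha : a ≤ a') (hb : b ≤ b') (hc : c ≤ c') :
    (hermThree a' b' c' x y z).PosSemidef := by
  rw [hermThree_posSemidef_iff_form] at h ⊢
  intro v
  have := h v
  have h0 := mul_le_mul_of_nonneg_right ha (Complex.normSq_nonneg (v 0))
  have h1 := mul_le_mul_of_nonneg_right hb (Complex.normSq_nonneg (v 1))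
  have h2 := mul_le_mul_of_nonneg_right hc (Complex.normSq_nonneg (v 2))
  linarith

theorem hermThree_posSemidef_of_forall_add {a b c e₀ : ℝ} {x y z : ℂ} (he₀ : 0 < e₀)
    (h : ∀ e, 0 < e → e ≤ e₀ → (hermThree (a + e) (b + e) (c + e) x y z).PosSemidef) :
    (hermThree a b c x y z).PosSemidef := by
  simp only [hermThree_posSemidef_iff_form] at h ⊢
  intro v
  by_contra! hneg
  set Q := a * Complex.normSq (v 0) + b * Complex.normSq (v 1) + c * Complex.normSq (v 2)
        + 2 * (conj (v 0) * x * v 1 + conj (v 0) * y * v 2 + conj (v 1) * z * v 2).re with hQ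
  set N := Complex.normSq (v 0) + Complex.normSq (v 1) + Complex.normSq (v 2) with hN
  have hN0 : 0 ≤ N :=
    add_nonneg (add_nonneg (Complex.normSq_nonneg _) (Complex.normSq_nonneg _))
      (Complex.normSq_nonneg _)
  have hpos : 0 < -Q / (N + 1) := div_pos (by linarith) (by linarith)
  have h1 := h (min e₀ (-Q / (N + 1))) (lt_min he₀ hpos) (min_le_left _ _) v
  have h2 : min e₀ (-Q / (N + 1)) * N ≤ -Q / (N + 1) * N :=
    mul_le_mul_of_nonneg_right (min_le_right _ _) hN0
  have h3 : -Q / (N + 1) * N = -Q - -Q / (N + 1) := by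
    field_simp
    ring
  have h4 : 0 ≤ Q + min e₀ (-Q / (N + 1)) * N := by
    rw [hQ, hN]
    linarith
  linarith

theorem hermThree_smul_posSemidef_iff {t : ℝ} (ht : 0 < t) (a b c : ℝ) (x y z : ℂ) :
    (hermThree (t * a) (t * b) (t * c) (t * x) (t * y) (t * z)).PosSemidef ↔
      (hermThree a b c x y z).PosSemidef := by
  simp only [hermThree_posSemidef_iff_form]
  refine forall_congr' fun v => ?_
  refine Iff.trans ?_ (mul_nonneg_iff_of_pos_left ht)
  apply iff_of_eq
  congr 1
  simp
  ring

end HermThree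

/-- Off-diagonal control of the entries of a positive semidefinite complex matrix. -/
theorem Matrix.PosSemidef.normSq_apply_le {m : Type*} {M : Matrix m m ℂ} (hM : M.PosSemidef)
    (i j : m) : Complex.normSq (M i j) ≤ (M i i).re * (M j j).re := by
  have h := hM.submatrix ![i, j]
  have hd := h.det_nonneg
  rw [Matrix.det_fin_two] at hd
  have h1 : M j i = star (M i j) := (hM.1.apply j i).symm
  have h2 : (M i i).im = 0 := ((Complex.le_def.1 hM.diag_nonneg).2).symm
  have h3 : (M j j).im = 0 := ((Complex.le_def.1 hM.diag_nonneg).2).symm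
  have := (Complex.le_def.1 hd).1
  simp [h1, h2, h3] at this
  rw [Complex.normSq_apply]
  linarith

theorem Matrix.PosDef.normSq_apply_lt {m : Type*} {M : Matrix m m ℂ} (hM : M.PosDef)
    {i j : m} (hij : i ≠ j) : Complex.normSq (M i j) < (M i i).re * (M j j).re := by
  have hinj : Function.Injective ![i, j] := by
    intro p q
    fin_cases p <;> fin_cases q <;> simp [hij, hij.symm]
  have h := hM.submatrix hinj
  have hd := h.det_pos
  rw [Matrix.det_fin_two] at hd
  have h1 : M j i = star (M i j) := (hM.1.apply j i).symm
  have h2 : (M i i).im = 0 := ((Complex.le_def.1 hM.posSemidef.diag_nonneg).2).symm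
  have h3 : (M j j).im = 0 := ((Complex.le_def.1 hM.posSemidef.diag_nonneg).2).symm
  have := (Complex.lt_def.1 hd).1
  simp [h1, h2, h3] at this
  rw [Complex.normSq_apply]
  linarith

/-! ### Midpoint comparisons force affinity -/

section AffineOfMidpoint

/-- A real function that preserves and reflects the comparison of midpoints agrees with its
chords. -/
theorem chord_eq_of_midpoint_iff {I : Set ℝ} (hI : I.OrdConnected) {g : ℝ → ℝ}
    (h : ∀ a ∈ I, ∀ x ∈ I, ∀ y ∈ I, 2 * y ≤ a + x ↔ 2 * g y ≤ g a + g x)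
    {u v p : ℝ} (hu : u ∈ I) (hv : v ∈ I) (huv : u < v) (hp : p ∈ Set.Icc u v) :
    (v - u) * g p = (v - p) * g u + (p - u) * g v := by
  have hmem : ∀ t, t ∈ Set.Icc u v → t ∈ I := fun t ht => hI.out hu hv ht
  have hmono : ∀ a ∈ I, ∀ b ∈ I, a ≤ b → g a ≤ g b := by
    intro a ha b hb hab
    have := (h b hb b hb a ha).1 (by linarith)
    linarith
  set σ : ℝ := (g v - g u) / (v - u) with hσ
  have hσ0 : 0 ≤ σ := div_nonneg (sub_nonneg.2 (hmono u hu v hv huv.le)) (by linarith)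
  have hσv : σ * (v - u) = g v - g u := by
    rw [hσ]; field_simp [(sub_pos.2 huv).ne']
  -- The deviation from the chord vanishes at both ends; monotonicity of `g` bounds it, so its
  -- supremum and infimum are finite.
  set k : ℝ → ℝ := fun t => g t - g u - σ * (t - u) with hk
  have hku : k u = 0 := by simp [hk]
  have hkv : k v = 0 := by simp only [hk]; linarith
  have hbd : ∀ t ∈ Set.Icc u v, k t ∈ Set.Icc (-(g v - g u)) (g v - g u) := by
    intro t ht
    have h1 := hmono u hu t (hmem t ht) ht.1
    have h2 := hmono t (hmem t ht) v hv ht.2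
    have h3 : 0 ≤ σ * (t - u) := mul_nonneg hσ0 (by linarith [ht.1])
    have h4 : σ * (t - u) ≤ σ * (v - u) := mul_le_mul_of_nonneg_left (by linarith [ht.2]) hσ0
    constructor <;> simp only [hk] <;> linarith
  have hne : (k '' Set.Icc u v).Nonempty := ⟨k u, u, ⟨le_rfl, huv.le⟩, rfl⟩
  have hba : BddAbove (k '' Set.Icc u v) := ⟨g v - g u, by rintro _ ⟨t, ht, rfl⟩; exact (hbd t ht).2⟩
  have hbb : BddBelow (k '' Set.Icc u v) :=
    ⟨-(g v - g u), by rintro _ ⟨t, ht, rfl⟩; exact (hbd t ht).1⟩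
  have hconv : ∀ a ∈ Set.Icc u v, ∀ x ∈ Set.Icc u v, ∀ y, 2 * y = a + x → 2 * k y ≤ k a + k x := by
    intro a ha x hx y hy
    have hyI : y ∈ Set.Icc u v := ⟨by linarith [ha.1, hx.1], by linarith [ha.2, hx.2]⟩
    have := (h a (hmem a ha) x (hmem x hx) y (hmem y hyI)).1 hy.le
    have hl : 2 * (σ * (y - u)) = σ * (a - u) + σ * (x - u) := by
      have : y = (a + x) / 2 := by linarith
      rw [this]; ring
    simp only [hk]
    linarith
  -- Failure of the comparison just above the midpoint gives midpoint concavity up to an error that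
  -- vanishes with τ; no continuity of `g` is assumed.
  have hconc : ∀ a ∈ Set.Icc u v, ∀ x ∈ Set.Icc u v, ∀ y ∈ Set.Icc u v, ∀ τ, 0 < τ →
      2 * y = a + x + 2 * τ → k a + k x < 2 * k y + 2 * (σ * τ) := by
    intro a ha x hx y hyI τ hτ hy
    have h1 := (h a (hmem a ha) x (hmem x hx) y (hmem y hyI)).not.1 (by linarith)
    have hl : 2 * (σ * (y - u)) = σ * (a - u) + σ * (x - u) + 2 * (σ * τ) := by
      have : y = (a + x + 2 * τ) / 2 := by linarith
      rw [this]; ring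
    simp only [hk]
    linarith
  have hupper : sSup (k '' Set.Icc u v) ≤ 0 := by
    by_contra! hM
    set M := sSup (k '' Set.Icc u v) with hMdef
    -- Reflecting the nearer endpoint through `t` stays in the interval and doubles the deviation,
    -- exceeding the supremum.
    obtain ⟨_, ⟨t, ht, rfl⟩, htM⟩ := exists_lt_of_lt_csSup hne (show M / 2 < M by linarith)
    have hle : ∀ s ∈ Set.Icc u v, k s ≤ M := fun s hs => le_csSup hba ⟨s, hs, rfl⟩
    rcases le_total (t - u) (v - t) with hc | hc
    · have hs : 2 * t - u ∈ Set.Icc u v := ⟨by linarith [ht.1], by linarith⟩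
      have := hconv u ⟨le_rfl, huv.le⟩ _ hs t (by ring)
      linarith [hle _ hs]
    · have hs : 2 * t - v ∈ Set.Icc u v := ⟨by linarith, by linarith [ht.2]⟩
      have := hconv v ⟨huv.le, le_rfl⟩ _ hs t (by ring)
      linarith [hle _ hs]
  have hlower : 0 ≤ sInf (k '' Set.Icc u v) := by
    by_contra! hM
    set m := sInf (k '' Set.Icc u v) with hmdef
    -- The same reflection, now with error at most -m/4: the reflected value is below 3m/2 - m/4 =
    -- 5m/4 < m.
    obtain ⟨_, ⟨t, ht, rfl⟩, htm⟩ := exists_lt_of_csInf_lt hne (show m < m * (3 / 4) by linarith)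
    have hle : ∀ s ∈ Set.Icc u v, m ≤ k s := fun s hs => csInf_le hbb ⟨s, hs, rfl⟩
    have htu : u < t := by
      rcases ht.1.eq_or_lt with h0 | h0
      · rw [← h0, hku] at htm; linarith
      · exact h0
    obtain ⟨τ₀, hτ₀, hτσ⟩ : ∃ τ₀ : ℝ, 0 < τ₀ ∧ 2 * (σ * τ₀) ≤ -m / 4 := by
      refine ⟨-m / 8 / (σ + 1), div_pos (by linarith) (by linarith), ?_⟩
      have h1 : σ * (-m / 8 / (σ + 1)) ≤ (σ + 1) * (-m / 8 / (σ + 1)) :=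
        mul_le_mul_of_nonneg_right (by linarith) (div_pos (by linarith) (by linarith)).le
      rw [mul_div_cancel₀ _ (by linarith : σ + 1 ≠ 0)] at h1
      linarith
    rcases le_or_gt (t - u) (v - t) with hc | hc
    · set τ := min τ₀ (t - u)
      have hτ : 0 < τ := lt_min hτ₀ (by linarith)
      have h1 : τ ≤ t - u := min_le_right _ _
      have h2 : σ * τ ≤ σ * τ₀ := mul_le_mul_of_nonneg_left (min_le_left _ _) hσ0
      have hs : 2 * t - u - 2 * τ ∈ Set.Icc u v := ⟨by linarith, by linarith⟩
      have := hconc u ⟨le_rfl, huv.le⟩ _ hs t ht τ hτ (by ring)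
      linarith [hle _ hs]
    · set τ := min τ₀ ((t - u - (v - t)) / 2)
      have hτ : 0 < τ := lt_min hτ₀ (by linarith)
      have h1 : τ ≤ (t - u - (v - t)) / 2 := min_le_right _ _
      have h2 : σ * τ ≤ σ * τ₀ := mul_le_mul_of_nonneg_left (min_le_left _ _) hσ0
      have hs : 2 * t - v - 2 * τ ∈ Set.Icc u v := ⟨by linarith, by linarith [ht.2]⟩
      have := hconc v ⟨huv.le, le_rfl⟩ _ hs t ht τ hτ (by ring)
      linarith [hle _ hs]
  have hp0 : k p = 0 := le_antisymm ((le_csSup hba ⟨p, hp, rfl⟩).trans hupper)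
    (hlower.trans (csInf_le hbb ⟨p, hp, rfl⟩))
  have h1 : g p = g u + σ * (p - u) := by simp only [hk] at hp0; linarith
  rw [h1]
  linear_combination (p - u) * hσv

theorem affine_of_midpoint_iff {I : Set ℝ} (hI : I.OrdConnected) {g : ℝ → ℝ}
    (h : ∀ a ∈ I, ∀ x ∈ I, ∀ y ∈ I, 2 * y ≤ a + x ↔ 2 * g y ≤ g a + g x)
    {u v : ℝ} (hu : u ∈ I) (hv : v ∈ I) (huv : u < v) :
    ∃ α γ : ℝ, ∀ r ∈ I, g r = α * r + γ := by
  have hvu : v - u ≠ 0 := (sub_pos.2 huv).ne'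
  refine ⟨(g v - g u) / (v - u), g u - (g v - g u) / (v - u) * u, fun r hr => ?_⟩
  have key : (v - u) * g r = (v - r) * g u + (r - u) * g v := by
    rcases lt_or_ge r u with h1 | h1
    · linear_combination -chord_eq_of_midpoint_iff hI h hr hv (h1.trans huv) ⟨h1.le, huv.le⟩
    · rcases le_or_gt r v with h2 | h2
      · exact chord_eq_of_midpoint_iff hI h hu hv huv ⟨h1, h2⟩
      · linear_combination -chord_eq_of_midpoint_iff hI h hu hr (huv.trans h2) ⟨huv.le, h2.le⟩
  field_simp
  linear_combination key

end AffineOfMidpoint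

/-! ### Multiplicative maps of the unit circle -/

section CircleRigidity

open ComplexConjugate

theorem Complex.eq_or_eq_conj_of_re_eq {u v : ℂ} (hu : ‖u‖ = 1) (hv : ‖v‖ = 1)
    (h : u.re = v.re) : u = v ∨ u = conj v := by
  have h1 : Complex.normSq u = 1 := by rw [Complex.normSq_eq_norm_sq, hu]; norm_num
  have h2 : Complex.normSq v = 1 := by rw [Complex.normSq_eq_norm_sq, hv]; norm_num
  rw [Complex.normSq_apply] at h1 h2
  have h3 : u.im * u.im = v.im * v.im := by rw [h] at h1; linarith
  rcases mul_self_eq_mul_self_iff.1 h3 with h4 | h4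
  · left; exact Complex.ext h h4
  · right; exact Complex.ext (by simpa using h) (by simpa using h4)

/-- Every unimodular number is a power of unimodular numbers close to `1`. -/
theorem Complex.exists_pow_eq_of_norm_one {s : ℂ} (hs : ‖s‖ = 1) {c : ℝ} (hc : c < 1) :
    ∃ (t : ℂ) (m : ℕ), ‖t‖ = 1 ∧ c ≤ t.re ∧ t ^ m = s := by
  have hlim : Filter.Tendsto (fun m : ℕ => Real.cos (s.arg / m)) Filter.atTop (nhds 1) := by
    have h := tendsto_const_div_atTop_nhds_zero_nat s.arg
    have := (Real.continuous_cos.tendsto 0).comp h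
    rwa [Real.cos_zero] at this
  obtain ⟨m, hm, hm0⟩ :=
    ((hlim.eventually (lt_mem_nhds hc)).and (Filter.eventually_gt_atTop 0)).exists
  refine ⟨Complex.exp ((s.arg / m : ℝ) * Complex.I), m, Complex.norm_exp_ofReal_mul_I _, ?_, ?_⟩
  · rw [Complex.exp_ofReal_mul_I_re]; exact hm.le
  · rw [← Complex.exp_nat_mul]
    have hm' : (m : ℂ) ≠ 0 := by exact_mod_cast hm0.ne'
    have : (m : ℂ) * (((s.arg / m : ℝ) : ℂ) * Complex.I) = s.arg * Complex.I := by
      push_cast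
      field_simp
    rw [this]
    have h2 := Complex.norm_mul_exp_arg_mul_I s
    rwa [hs, Complex.ofReal_one, one_mul] at h2

/-- A multiplicative self-map of the unit circle preserving real parts near `1` is the identity or
complex conjugation. -/
theorem circle_hom_eq_id_or_conj {F : ℂ → ℂ} (hnorm : ∀ s, ‖s‖ = 1 → ‖F s‖ = 1)
    (hone : F 1 = 1) (hmul : ∀ s t, ‖s‖ = 1 → ‖t‖ = 1 → F (s * t) = F s * F t)
    {c₀ : ℝ} (hc₀ : c₀ < 1) (hre : ∀ s, ‖s‖ = 1 → c₀ ≤ s.re → (F s).re = s.re) :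
    (∀ s, ‖s‖ = 1 → F s = s) ∨ (∀ s, ‖s‖ = 1 → F s = conj s) := by
  have hpow : ∀ t, ‖t‖ = 1 → ∀ m : ℕ, F (t ^ m) = F t ^ m := by
    intro t ht m
    induction m with
    | zero => simpa using hone
    | succ m ih => rw [pow_succ, hmul _ _ (by simp [ht]) ht, ih, pow_succ]
  have hor : ∀ s, ‖s‖ = 1 → F s = s ∨ F s = conj s := by
    intro s hs
    obtain ⟨t, m, ht, htc, rfl⟩ := Complex.exists_pow_eq_of_norm_one hs hc₀
    rw [hpow t ht, map_pow]
    rcases Complex.eq_or_eq_conj_of_re_eq (hnorm t ht) ht (hre t ht htc) with h | h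
    · left; rw [h]
    · right; rw [h]
  -- A group is not the union of two proper subgroups: if F conjugates s non-trivially and fixes a
  -- non-real t, then F(st) = conj(s) · t is neither st nor its conjugate.
  by_cases hall : ∀ s, ‖s‖ = 1 → F s = s
  · exact Or.inl hall
  right
  push Not at hall
  obtain ⟨s, hs, hFs⟩ := hall
  have hs0 : s ≠ 0 := by rintro rfl; simp at hs
  have hFs' := (hor s hs).resolve_left hFs
  intro t ht
  have ht0 : t ≠ 0 := by rintro rfl; simp at ht
  by_contra hFt
  have hFt' := (hor t ht).resolve_right hFt
  have h1 := hmul s t hs ht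
  rw [hFs', hFt'] at h1
  rcases hor (s * t) (by simp [hs, ht]) with h | h
  · rw [h1] at h
    exact hFs (hFs'.trans (mul_right_cancel₀ ht0 h))
  · rw [h1, map_mul] at h
    exact hFt (hFt'.trans (mul_left_cancel₀ ((map_ne_zero _).2 hs0) h))

end CircleRigidity

/-! ### Maps fixing the radii are the identity or conjugation -/

section Rigidity

open ComplexConjugate

theorem normSq_le_sq_iff (z : ℂ) {r : ℝ} (hr : 0 ≤ r) : Complex.normSq z ≤ r ^ 2 ↔ ‖z‖ ≤ r := by
  rw [Complex.normSq_eq_norm_sq]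
  exact pow_le_pow_iff_left₀ (norm_nonneg _) hr two_ne_zero

theorem schurNonneg_two (z : ℂ) {r : ℝ} (hr : 0 ≤ r) :
    SchurNonneg r r r z z r ↔ ‖z‖ ≤ r := by
  rw [← normSq_le_sq_iff z hr]
  simp [SchurNonneg, mul_comm z, sq]

/-- The difference of the two sides of the last Schur inequality is affine in Re s with positive
slope; the relation between y and c places its zero at c. -/
theorem schurNonneg_threshold_iff {q ρ c y : ℝ} {s : ℂ} (hq : 0 < q) (hρ : 0 < ρ)
    (hs : ‖s‖ = 1) (hy0 : 0 < y) (hy1 : y ≤ 1) (hy : 2 * y ^ 2 * (1 - ρ * c) = 1 - ρ ^ 2) :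
    SchurNonneg q q q (q * ρ * s) (q * y : ℝ) (q * y : ℝ) ↔ c ≤ s.re := by
  have hs1 : s.re * s.re + s.im * s.im = 1 := by
    rw [← Complex.normSq_apply, Complex.normSq_eq_norm_sq, hs]; norm_num
  have h1 : Complex.normSq ((q * y : ℝ) : ℂ) ≤ q * q := by
    rw [Complex.normSq_ofReal]
    have : q * y ≤ q := by nlinarith
    exact mul_self_le_mul_self (by positivity) this
  have h2 : (q * q - Complex.normSq ((q * y : ℝ) : ℂ)) * (q * q - Complex.normSq ((q * y : ℝ) : ℂ))
      - Complex.normSq (q * (q * ρ * s) - ((q * y : ℝ) : ℂ) * conj ((q * y : ℝ) : ℂ))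
      = (q ^ 4 * (2 * y ^ 2 * ρ)) * (s.re - c) := by
    simp [Complex.normSq_apply]
    linear_combination (-q ^ 4 * ρ ^ 2) * hs1 - q ^ 4 * hy
  have h3 : 0 < q ^ 4 * (2 * y ^ 2 * ρ) := by positivity
  simp only [SchurNonneg, h1, true_and]
  rw [← sub_nonneg, h2, mul_nonneg_iff_of_pos_left h3, sub_nonneg]

/-- The lower bound on c is the threshold belonging to y = ρ. Keeping y in [ρ, 1] keeps the radius
qy between qρ and q. -/
theorem exists_threshold {ρ c : ℝ} (hρ : 0 < ρ) (hρ1 : ρ < 1)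
    (hc : (3 * ρ ^ 2 - 1) / (2 * ρ ^ 3) ≤ c) (hc1 : c ≤ 1) :
    ∃ y, ρ ≤ y ∧ y ≤ 1 ∧ 2 * y ^ 2 * (1 - ρ * c) = 1 - ρ ^ 2 := by
  have hpos : 0 < 1 - ρ * c := by nlinarith
  refine ⟨√((1 - ρ ^ 2) / (2 * (1 - ρ * c))), ?_, ?_, ?_⟩
  · apply Real.le_sqrt_of_sq_le
    rw [le_div_iff₀ (by positivity)]
    rw [div_le_iff₀ (by positivity)] at hc
    linarith
  · rw [Real.sqrt_le_one, div_le_one (by positivity)]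
    nlinarith [sq_nonneg (ρ - 1)]
  · rw [Real.sq_sqrt (div_nonneg (by nlinarith) (by positivity))]
    field_simp

theorem id_or_conj_of_schurNonneg_iff {I : Set ℝ} (hpos : I ⊆ Set.Ioi 0) (hI : I.OrdConnected)
    {r₀ q₀ : ℝ} (hr₀ : r₀ ∈ I) (hq₀ : q₀ ∈ I) (hrq : r₀ < q₀) {f : ℂ → ℂ}
    (hf : ∀ r ∈ I, f r = r)
    (h : ∀ a ∈ I, ∀ b ∈ I, ∀ c ∈ I, ∀ x y z : ℂ, ‖x‖ ∈ I → ‖y‖ ∈ I → ‖z‖ ∈ I →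
      (SchurNonneg a b c x y z ↔ SchurNonneg a b c (f x) (f y) (f z))) :
    (∀ z, ‖z‖ ∈ I → f z = z) ∨ (∀ z, ‖z‖ ∈ I → f z = conj z) := by
  have hIpos : ∀ r ∈ I, 0 < r := fun r hr => hpos hr
  have hnormI : ∀ r ∈ I, ∀ s : ℂ, ‖s‖ = 1 → ‖(r : ℂ) * s‖ ∈ I := by
    intro r hr s hs
    rwa [norm_mul, hs, mul_one, Complex.norm_real, Real.norm_eq_abs, abs_of_pos (hIpos r hr)]
  have hnormI' : ∀ r ∈ I, ‖(r : ℂ)‖ ∈ I := by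
    intro r hr
    simpa using hnormI r hr 1 (by simp)
  have hle_iff : ∀ r ∈ I, ∀ z : ℂ, ‖z‖ ∈ I → (‖z‖ ≤ r ↔ ‖f z‖ ≤ r) := by
    intro r hr z hz
    have := h r hr r hr r hr z z r hz hz (hnormI' r hr)
    rwa [hf r hr, schurNonneg_two _ (hIpos r hr).le, schurNonneg_two _ (hIpos r hr).le] at this
  -- A drop in modulus would be seen by the test radius max(r, ‖f z‖). A least radius of I is not
  -- covered; `hradial` settles it.
  have hnorm_of_lt : ∀ z : ℂ, ‖z‖ ∈ I → (∃ r ∈ I, r < ‖z‖) → ‖f z‖ = ‖z‖ := by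
    rintro z hz ⟨r, hr, hrz⟩
    refine le_antisymm ((hle_iff _ hz z hz).1 le_rfl) ?_
    by_contra! hlt
    have hmem : max r ‖f z‖ ∈ I := hI.out hr hz ⟨le_max_left _ _, max_le hrz.le hlt.le⟩
    have := (hle_iff _ hmem z hz).2 (le_max_right _ _)
    exact absurd this (not_le.2 (max_lt hrz hlt))
  have hnorm_mul : ∀ r ∈ I, ∀ s : ℂ, ‖s‖ = 1 → ‖(r : ℂ) * s‖ = r := by
    intro r hr s hs
    rw [norm_mul, hs, mul_one, Complex.norm_real, Real.norm_eq_abs, abs_of_pos (hIpos r hr)]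
  -- The matrix with diagonal q, q, r and entries qs, rs, r gives equality in the last Schur
  -- condition. With t = ‖f(rs)‖, its image and the triangle inequality yield q(r - t)² ≤ 0, and
  -- then equality in Cauchy–Schwarz aligns f(qs) with f(rs).
  have hradial : ∀ r ∈ I, ∀ q ∈ I, r < q → ∀ s : ℂ, ‖s‖ = 1 →
      ‖f (r * s)‖ = r ∧ r * f (q * s) = q * f (r * s) := by
    intro r hr q hq hlt s hs
    have hr0 := hIpos r hr
    have hq0 := hIpos q hq
    have hs1 : s.re * s.re + s.im * s.im = 1 := by
      rw [← Complex.normSq_apply, Complex.normSq_eq_norm_sq, hs]; norm_num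
    have h1 := (h q hq q hq r hr (q * s) (r * s) r (hnormI q hq s hs) (hnormI r hr s hs)
      (hnormI' r hr)).1 (by
        have e1 : Complex.normSq (r * s) = r ^ 2 := by
          simp [Complex.normSq_apply]; linear_combination r ^ 2 * hs1
        have e2 : Complex.normSq (r * (q * s) - r * s * conj (r : ℂ)) = (q * r - r ^ 2) ^ 2 := by
          simp [Complex.normSq_apply]; linear_combination (q * r - r ^ 2) ^ 2 * hs1
        refine ⟨?_, ?_, ?_⟩
        · rw [e1]; nlinarith
        · rw [Complex.normSq_ofReal]; nlinarith
        · rw [e1, e2, Complex.normSq_ofReal]; apply le_of_eq; ring)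
    rw [hf r hr] at h1
    obtain ⟨-, -, h3⟩ := h1
    have hqn : ‖f (q * s)‖ = q := by
      have hn := hnorm_mul q hq s hs
      rw [hnorm_of_lt _ (hnormI q hq s hs) ⟨r, hr, by rwa [hn]⟩, hn]
    have htr : ‖f (r * s)‖ ≤ r := (hle_iff r hr _ (hnormI r hr s hs)).1 (hnorm_mul r hr s hs).le
    have h4 : r * ‖f (q * s) - f (r * s)‖ ^ 2 ≤ (q * r - ‖f (r * s)‖ ^ 2) * (q - r) := by
      have e3 : r * f (q * s) - f (r * s) * conj (r : ℂ) = r * (f (q * s) - f (r * s)) := by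
        rw [Complex.conj_ofReal]; ring
      rw [e3, Complex.normSq_mul, Complex.normSq_ofReal,
        Complex.normSq_eq_norm_sq, Complex.normSq_eq_norm_sq] at h3
      refine le_of_mul_le_mul_left ?_ hr0
      linarith
    have h5 : q - ‖f (r * s)‖ ≤ ‖f (q * s) - f (r * s)‖ := by
      have := norm_sub_norm_le (f (q * s)) (f (r * s))
      rwa [hqn] at this
    have hrn : ‖f (r * s)‖ = r := by
      have h6 : (q - ‖f (r * s)‖) ^ 2 ≤ ‖f (q * s) - f (r * s)‖ ^ 2 :=
        pow_le_pow_left₀ (by linarith) h5 2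
      have h7 : q * (r - ‖f (r * s)‖) ^ 2 ≤ 0 := by
        have := mul_le_mul_of_nonneg_left h6 hr0.le
        linarith
      have h8 : (r - ‖f (r * s)‖) ^ 2 ≤ 0 := by
        by_contra! hc
        linarith [mul_pos hq0 hc]
      have := pow_eq_zero_iff two_ne_zero |>.1 (le_antisymm h8 (sq_nonneg _))
      linarith
    refine ⟨hrn, ?_⟩
    rw [hrn, ← Complex.normSq_eq_norm_sq, Complex.normSq_sub, Complex.normSq_eq_norm_sq,
      Complex.normSq_eq_norm_sq, hqn, hrn] at h4
    have h9 : q * r ≤ (f (q * s) * conj (f (r * s))).re := by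
      have : r * (q ^ 2 + r ^ 2 - 2 * (f (q * s) * conj (f (r * s))).re) ≤ r * (q - r) ^ 2 := by
        linarith
      linarith [le_of_mul_le_mul_left this hr0]
    rw [← sub_eq_zero, ← Complex.normSq_eq_zero]
    refine le_antisymm ?_ (Complex.normSq_nonneg _)
    rw [Complex.normSq_sub, Complex.normSq_mul, Complex.normSq_mul, Complex.normSq_ofReal,
      Complex.normSq_ofReal, Complex.normSq_eq_norm_sq, Complex.normSq_eq_norm_sq, hqn, hrn]
    have e4 : (r * f (q * s) * conj (q * f (r * s))).re
        = r * q * (f (q * s) * conj (f (r * s))).re := by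
      simp; ring
    rw [e4]
    have := mul_le_mul_of_nonneg_left h9 (mul_pos hr0 hq0).le
    linarith
  have hq₀0 := hIpos q₀ hq₀
  have hq₀c : (q₀ : ℂ) ≠ 0 := by exact_mod_cast hq₀0.ne'
  set F : ℂ → ℂ := fun s => f (q₀ * s) / q₀ with hF
  have hq₀F : ∀ s, f (q₀ * s) = q₀ * F s := fun s => by simp only [hF]; field_simp
  have hfF : ∀ r ∈ I, ∀ s, ‖s‖ = 1 → f (r * s) = r * F s := by
    intro r hr s hs
    rcases lt_trichotomy r q₀ with hlt | rfl | hlt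
    · have := (hradial r hr q₀ hq₀ hlt s hs).2
      rw [hq₀F] at this
      apply mul_left_cancel₀ hq₀c
      linear_combination -this
    · exact hq₀F s
    · have := (hradial q₀ hq₀ r hr hlt s hs).2
      rw [hq₀F] at this
      apply mul_left_cancel₀ hq₀c
      linear_combination this
  have hFnorm : ∀ s, ‖s‖ = 1 → ‖F s‖ = 1 := by
    intro s hs
    have := (hradial r₀ hr₀ q₀ hq₀ hrq s hs).1
    rw [hfF r₀ hr₀ s hs, norm_mul, Complex.norm_real, Real.norm_eq_abs,
      abs_of_pos (hIpos r₀ hr₀)] at this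
    exact mul_left_cancel₀ (hIpos r₀ hr₀).ne' (by rw [this, mul_one])
  have hFone : F 1 = 1 := by
    simp only [hF, mul_one]
    rw [hf q₀ hq₀, div_self hq₀c]
  have hnormSq_one : ∀ s : ℂ, ‖s‖ = 1 → Complex.normSq s = 1 := fun s hs => by
    rw [Complex.normSq_eq_norm_sq, hs]; norm_num
  -- The rank-one matrix with entries q₀s, q₀st, q₀t is semidefinite; for its image the right side
  -- of the last Schur inequality is zero, so the left side vanishes too.
  have hFmul : ∀ s t, ‖s‖ = 1 → ‖t‖ = 1 → F (s * t) = F s * F t := by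
    intro s t hs ht
    have hst : ‖s * t‖ = 1 := by rw [norm_mul, hs, ht, mul_one]
    have hns : ∀ u : ℂ, ‖u‖ = 1 → Complex.normSq (q₀ * u) = q₀ * q₀ := fun u hu => by
      rw [Complex.normSq_mul, hnormSq_one u hu, Complex.normSq_ofReal, mul_one]
    have htc : t * conj t = 1 := by rw [Complex.mul_conj, hnormSq_one t ht, Complex.ofReal_one]
    have h1 := ((h q₀ hq₀ q₀ hq₀ q₀ hq₀ (q₀ * s) (q₀ * (s * t)) (q₀ * t) (hnormI _ hq₀ s hs)
      (hnormI _ hq₀ _ hst) (hnormI _ hq₀ t ht)).1 (by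
        refine ⟨(hns _ hst).le, (hns _ ht).le, ?_⟩
        have : (q₀ : ℂ) * (q₀ * s) - q₀ * (s * t) * conj (q₀ * t) = 0 := by
          rw [map_mul, Complex.conj_ofReal]
          linear_combination (-(q₀ : ℂ) ^ 2 * s) * htc
        rw [this, hns _ hst, hns _ ht]; simp)).2.2
    rw [hq₀F, hq₀F, hq₀F, hns _ (hFnorm _ hst), sub_self, zero_mul] at h1
    have h2 := Complex.normSq_eq_zero.1 (le_antisymm h1 (Complex.normSq_nonneg _))
    have hFtc : F t * conj (F t) = 1 := by
      rw [Complex.mul_conj, hnormSq_one _ (hFnorm t ht), Complex.ofReal_one]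
    rw [map_mul, Complex.conj_ofReal] at h2
    have h3 : F s = F (s * t) * conj (F t) := by
      apply mul_left_cancel₀ (pow_ne_zero 2 hq₀c)
      linear_combination h2
    rw [h3]
    linear_combination (-F (s * t)) * hFtc
  have hρ0 : 0 < r₀ / q₀ := div_pos (hIpos _ hr₀) hq₀0
  have hρ1 : r₀ / q₀ < 1 := (div_lt_one hq₀0).2 hrq
  set ρ := r₀ / q₀ with hρ
  have hqρ : q₀ * ρ = r₀ := by rw [hρ]; field_simp
  have hthr : ∀ c, (3 * ρ ^ 2 - 1) / (2 * ρ ^ 3) ≤ c → c ≤ 1 → ∀ s, ‖s‖ = 1 →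
      (c ≤ s.re ↔ c ≤ (F s).re) := by
    intro c hc hc1 s hs
    obtain ⟨y, hy0, hy1, hy⟩ := exists_threshold hρ0 hρ1 hc hc1
    have hyI : q₀ * y ∈ I := by
      refine hI.out hr₀ hq₀ ⟨?_, ?_⟩
      · rw [← hqρ]; exact mul_le_mul_of_nonneg_left hy0 hq₀0.le
      · nlinarith
    have hr₀s : (q₀ : ℂ) * ρ * s = r₀ * s := by rw [← hqρ]; push_cast; ring
    have hr₀F : (r₀ : ℂ) * F s = q₀ * ρ * F s := by rw [← hqρ]; push_cast; ring
    have := h q₀ hq₀ q₀ hq₀ q₀ hq₀ (q₀ * ρ * s) (q₀ * y : ℝ) (q₀ * y : ℝ)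
      (by rw [hr₀s]; exact hnormI _ hr₀ s hs) (hnormI' _ hyI) (hnormI' _ hyI)
    rwa [hf _ hyI, hr₀s, hfF _ hr₀ s hs, ← hr₀s, hr₀F,
      schurNonneg_threshold_iff hq₀0 hρ0 hs (hρ0.trans_le hy0) hy1 hy,
      schurNonneg_threshold_iff hq₀0 hρ0 (hFnorm s hs) (hρ0.trans_le hy0) hy1 hy] at this
  have hre_le : ∀ s : ℂ, ‖s‖ = 1 → s.re ≤ 1 := fun s hs => hs ▸ Complex.re_le_norm s
  have hc₀ : (3 * ρ ^ 2 - 1) / (2 * ρ ^ 3) < 1 := by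
    rw [div_lt_one (by positivity)]
    -- 2ρ³ - 3ρ² + 1 = (1 - ρ)²(1 + 2ρ).
    nlinarith [mul_pos (pow_pos (sub_pos.2 hρ1) 2) (show 0 < 1 + 2 * ρ by linarith)]
  have hFre : ∀ s, ‖s‖ = 1 → (3 * ρ ^ 2 - 1) / (2 * ρ ^ 3) ≤ s.re → (F s).re = s.re := by
    intro s hs hc
    have h1 := (hthr s.re hc (hre_le s hs) s hs).1 le_rfl
    exact le_antisymm ((hthr (F s).re (hc.trans h1) (hre_le _ (hFnorm s hs)) s hs).2 le_rfl) h1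
  have hpolar : ∀ z : ℂ, ‖z‖ ∈ I → ∃ s, ‖s‖ = 1 ∧ z = ‖z‖ * s := by
    intro z hz
    have hz0 : (‖z‖ : ℂ) ≠ 0 := by exact_mod_cast (hIpos _ hz).ne'
    refine ⟨z / ‖z‖, ?_, by field_simp⟩
    rw [norm_div, Complex.norm_real, norm_norm, div_self (hIpos _ hz).ne']
  rcases circle_hom_eq_id_or_conj hFnorm hFone hFmul hc₀ hFre with hid | hconj
  · left
    intro z hz
    obtain ⟨s, hs, hzs⟩ := hpolar z hz
    rw [hzs, hfF _ hz s hs, hid s hs]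
  · right
    intro z hz
    obtain ⟨s, hs, hzs⟩ := hpolar z hz
    rw [hzs, hfF _ hz s hs, hconj s hs, map_mul, Complex.conj_ofReal]

end Rigidity

/-! ### Linearity on the positive radii -/

section Linearity

open ComplexConjugate

theorem hermThree_map {f : ℂ → ℂ} {g : ℝ → ℝ} {a b c : ℝ} {x y z : ℂ} (ha : f a = g a)
    (hb : f b = g b) (hc : f c = g c) (hx : f (conj x) = conj (f x))
    (hy : f (conj y) = conj (f y)) (hz : f (conj z) = conj (f z)) :
    (hermThree a b c x y z).map f = hermThree (g a) (g b) (g c) (f x) (f y) (f z) := by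
  ext i j
  fin_cases i <;> fin_cases j <;> simp [hermThree, ha, hb, hc, hx, hy, hz]

/-- The last Schur inequality reduces to |x - y| ≤ a - y, whose only active half, given x ≤ a, is
the midpoint comparison. -/
theorem schurNonneg_isoceles_iff {a x y : ℝ} (hy : 0 < y) (hxa : x ≤ a) :
    SchurNonneg a a y x y y ↔ y ≤ a ∧ 2 * y ≤ a + x := by
  have h1 : Complex.normSq (y * x - y * conj (y : ℂ)) = (y * (x - y)) ^ 2 := by
    simp [Complex.normSq_apply]; ring
  simp only [SchurNonneg, h1, Complex.normSq_ofReal, mul_le_mul_iff_left₀ hy]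
  constructor
  · rintro ⟨h2, -, h3⟩
    refine ⟨h2, ?_⟩
    have h4 : y ^ 2 * (x - y) ^ 2 ≤ y ^ 2 * (a - y) ^ 2 := by linarith
    have h5 := abs_le_of_sq_le_sq (le_of_mul_le_mul_left h4 (by positivity)) (by linarith)
    linarith [(abs_le.1 h5).1]
  · rintro ⟨h2, h3⟩
    refine ⟨h2, h2, ?_⟩
    have h4 : (x - y) ^ 2 ≤ (a - y) ^ 2 := sq_le_sq' (by linarith) (by linarith)
    have := mul_le_mul_of_nonneg_left h4 (sq_nonneg y)
    linarith

/-- An entrywise map preserving and reflecting positive semidefiniteness of Hermitian `3 × 3`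
matrices with entries of modulus in a nondegenerate interval is a positive multiple of the identity
or of complex conjugation. -/
theorem linear_or_conjLinear_of_posSemidef_iff {I : Set ℝ} (hpos : I ⊆ Set.Ioi 0)
    (hI : I.OrdConnected) {r₀ q₀ : ℝ} (hr₀ : r₀ ∈ I) (hq₀ : q₀ ∈ I) (hrq : r₀ < q₀) {f : ℂ → ℂ}
    (h : ∀ a ∈ I, ∀ b ∈ I, ∀ c ∈ I, ∀ x y z : ℂ, ‖x‖ ∈ I → ‖y‖ ∈ I → ‖z‖ ∈ I →
      ((hermThree a b c x y z).PosSemidef ↔ ((hermThree a b c x y z).map f).PosSemidef)) :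
    ∃ α : ℝ, 0 < α ∧
      ((∀ z, ‖z‖ ∈ I → f z = α * z) ∨ (∀ z, ‖z‖ ∈ I → f z = α * conj z)) := by
  have hIpos : ∀ r ∈ I, 0 < r := fun r hr => hpos hr
  have hnormI : ∀ r ∈ I, ‖(r : ℂ)‖ ∈ I := by
    intro r hr
    rwa [Complex.norm_real, Real.norm_eq_abs, abs_of_pos (hIpos r hr)]
  set g : ℝ → ℝ := fun r => (f r).re with hg
  have hpsd_two : ∀ z : ℂ, ‖z‖ ∈ I → ((hermThree ‖z‖ ‖z‖ ‖z‖ z z ‖z‖).map f).PosSemidef := by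
    intro z hz
    rw [← h _ hz _ hz _ hz _ _ _ hz hz (hnormI _ hz), hermThree_posSemidef_iff (hIpos _ hz),
      schurNonneg_two _ (norm_nonneg z)]
  have hconj : ∀ z : ℂ, ‖z‖ ∈ I → f (conj z) = conj (f z) := by
    intro z hz
    simpa [hermThree] using ((hpsd_two z hz).1.apply 1 0).symm
  have hfg : ∀ r ∈ I, f r = g r := by
    intro r hr
    have := hconj r (hnormI r hr)
    rw [Complex.conj_ofReal] at this
    exact (Complex.conj_eq_iff_re.1 this.symm).symm
  have hgnonneg : ∀ r ∈ I, 0 ≤ g r := by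
    intro r hr
    have h1 := (hpsd_two r (hnormI r hr)).diag_nonneg (i := 0)
    rw [Complex.norm_real, Real.norm_eq_abs, abs_of_pos (hIpos r hr)] at h1
    have h2 : 0 ≤ f r := by simpa [hermThree] using h1
    exact (Complex.le_def.1 h2).1
  have h' : ∀ a ∈ I, ∀ b ∈ I, ∀ c ∈ I, ∀ x y z : ℂ, ‖x‖ ∈ I → ‖y‖ ∈ I → ‖z‖ ∈ I →
      ((hermThree a b c x y z).PosSemidef ↔
        (hermThree (g a) (g b) (g c) (f x) (f y) (f z)).PosSemidef) := by
    intro a ha b hb c hc x y z hx hy hz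
    rw [h a ha b hb c hc x y z hx hy hz, hermThree_map (hfg a ha) (hfg b hb) (hfg c hc)
      (hconj x hx) (hconj y hy) (hconj z hz)]
  have hlt : ∀ r ∈ I, ∀ s ∈ I, r < s → g r < g s := by
    intro r hr s hs hrs
    have h1 : ¬ (hermThree r r r s s r).PosSemidef := by
      rw [hermThree_posSemidef_iff (hIpos r hr), schurNonneg_two _ (hIpos r hr).le,
        Complex.norm_real, Real.norm_eq_abs, abs_of_pos (hIpos s hs)]
      exact not_le.2 hrs
    rw [h' r hr r hr r hr s s r (hnormI s hs) (hnormI s hs) (hnormI r hr), hfg s hs, hfg r hr] at h1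
    by_contra! hle
    apply h1
    rcases (hgnonneg r hr).eq_or_lt with h0 | h0
    · have h2 : g s = 0 := le_antisymm (by rwa [← h0] at hle) (hgnonneg s hs)
      rw [← h0, h2]
      simpa using hermThree_zero_posSemidef
    · rw [hermThree_posSemidef_iff h0, schurNonneg_two _ h0.le, Complex.norm_real,
        Real.norm_eq_abs, abs_of_nonneg (hgnonneg s hs)]
      exact hle
  have hle_iff : ∀ r ∈ I, ∀ s ∈ I, (g r ≤ g s ↔ r ≤ s) := by
    have : StrictMonoOn g I := fun r hr s hs hrs => hlt r hr s hs hrs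
    exact fun r hr s hs => this.le_iff_le hr hs
  have hgpos : ∀ r ∈ I, ∀ s ∈ I, r < s → 0 < g s := fun r hr s hs hrs =>
    (hgnonneg r hr).trans_lt (hlt r hr s hs hrs)
  have hmid : ∀ a ∈ I, ∀ x ∈ I, ∀ y ∈ I, 2 * y ≤ a + x ↔ 2 * g y ≤ g a + g x := by
    have key : ∀ a ∈ I, ∀ x ∈ I, ∀ y ∈ I, x ≤ a → (2 * y ≤ a + x ↔ 2 * g y ≤ g a + g x) := by
      intro a ha x hx y hy hxa
      have hgxa := (hle_iff x hx a ha).2 hxa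
      -- For y ≤ x both comparisons hold by monotonicity. The Schur test needs `g y` positive, which
      -- y > x guarantees.
      rcases le_or_gt y x with hyx | hyx
      · have := (hle_iff y hy x hx).2 hyx
        exact ⟨fun _ => by linarith, fun _ => by linarith⟩
      have hgy := hgpos x hx y hy hyx
      have h1 := h' a ha a ha y hy x y y (hnormI x hx) (hnormI y hy) (hnormI y hy)
      rw [hermThree_posSemidef_iff (hIpos y hy), hermThree_posSemidef_iff hgy, hfg x hx, hfg y hy,
        schurNonneg_isoceles_iff (hIpos y hy) hxa, schurNonneg_isoceles_iff hgy hgxa] at h1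
      constructor
      · intro h2
        exact (h1.1 ⟨by linarith, h2⟩).2
      · intro h2
        exact (h1.2 ⟨by linarith, h2⟩).2
    intro a ha x hx y hy
    rcases le_total x a with hxa | hxa
    · exact key a ha x hx y hy hxa
    · rw [add_comm a, add_comm (g a)]
      exact key x hx a ha y hy hxa
  obtain ⟨α, γ, haff⟩ := affine_of_midpoint_iff hI hmid hr₀ hq₀ hrq
  have hα : 0 < α := by
    have := hlt r₀ hr₀ q₀ hq₀ hrq
    rw [haff r₀ hr₀, haff q₀ hq₀] at this
    by_contra! hc
    nlinarith
  have hgm : ∀ a ∈ I, ∀ c ∈ I, a < q₀ → (c ^ 2 ≤ a * q₀ ↔ g c ^ 2 ≤ g a * g q₀) := by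
    intro a ha c hc haq
    have hgq := hgpos a ha q₀ hq₀ haq
    have h1 := h' a ha q₀ hq₀ q₀ hq₀ c c q₀ (hnormI c hc) (hnormI c hc) (hnormI q₀ hq₀)
    rw [hermThree_posSemidef_iff (hIpos _ hq₀), hermThree_posSemidef_iff hgq, hfg c hc,
      hfg q₀ hq₀] at h1
    simpa [SchurNonneg, mul_comm, sq] using h1
  have hγ : γ = 0 := by
    have hr0 := hIpos r₀ hr₀
    have hq0 := hIpos q₀ hq₀
    have hm2 : √(r₀ * q₀) ^ 2 = r₀ * q₀ := Real.sq_sqrt (by positivity)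
    set m := √(r₀ * q₀) with hm
    have hrm : r₀ < m := by
      apply Real.lt_sqrt_of_sq_lt
      nlinarith
    have hmq : m < q₀ := by
      rw [hm, Real.sqrt_lt' hq0]
      nlinarith
    have hmI : ∀ t, m ≤ t → t ≤ q₀ → t ∈ I := fun t h1 h2 =>
      hI.out hr₀ hq₀ ⟨hrm.le.trans h1, h2⟩
    have hsum : 0 < r₀ + q₀ - 2 * m := by
      have : 0 < (q₀ - r₀) ^ 2 := by
        have := sub_pos.2 hrq
        positivity
      nlinarith
    have hupper : (α * m + γ) ^ 2 ≤ (α * r₀ + γ) * (α * q₀ + γ) := by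
      have := (hgm r₀ hr₀ m (hmI m le_rfl hmq.le) hrq).1 hm2.le
      rwa [haff _ hr₀, haff _ hq₀, haff _ (hmI m le_rfl hmq.le)] at this
    -- The comparison fails at every t slightly above the geometric mean m; let t decrease to m.
    -- Together with `hupper` this leaves αγ(r₀ + q₀ - 2m) = 0.
    have hlower : (α * r₀ + γ) * (α * q₀ + γ) ≤ (α * m + γ) ^ 2 := by
      have hcont : Filter.Tendsto (fun t : ℝ => (α * t + γ) ^ 2) (nhdsWithin m (Set.Ioi m))
          (nhds ((α * m + γ) ^ 2)) :=
        (Continuous.tendsto (by fun_prop) m).mono_left nhdsWithin_le_nhds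
      refine ge_of_tendsto hcont ?_
      filter_upwards [Ioo_mem_nhdsGT hmq] with t ht
      have htI := hmI t ht.1.le ht.2.le
      have := (hgm r₀ hr₀ t htI hrq).not.1 (by
        rw [not_le, ← hm2]
        exact pow_lt_pow_left₀ ht.1 (hr0.trans hrm).le two_ne_zero)
      rw [haff _ hr₀, haff _ hq₀, haff _ htI] at this
      exact (not_le.1 this).le
    have heq : α * γ * (r₀ + q₀ - 2 * m) = 0 := by
      have := le_antisymm hupper hlower
      linear_combination α ^ 2 * hm2 - this
    rcases mul_eq_zero.1 heq with h1 | h1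
    · exact (mul_eq_zero.1 h1).resolve_left hα.ne'
    · exact absurd h1 hsum.ne'
  have hαc : (α : ℂ) ≠ 0 := by exact_mod_cast hα.ne'
  have hglin : ∀ r ∈ I, g r = α * r := fun r hr => by rw [haff r hr, hγ, add_zero]
  have hunit := id_or_conj_of_schurNonneg_iff hpos hI hr₀ hq₀ hrq (f := fun z => f z / α)
    (fun r hr => by
      rw [hfg r hr, hglin r hr, Complex.ofReal_mul]
      field_simp)
    (fun a ha b hb c hc x y z hx hy hz => by
      have h1 := h' a ha b hb c hc x y z hx hy hz
      have hdiv : ∀ w : ℂ, w = α * (w / α) := fun w => by field_simp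
      rw [hglin a ha, hglin b hb, hglin c hc, hdiv (f x), hdiv (f y), hdiv (f z),
        hermThree_smul_posSemidef_iff hα, hermThree_posSemidef_iff (hIpos c hc),
        hermThree_posSemidef_iff (hIpos c hc)] at h1
      exact h1)
  refine ⟨α, hα, hunit.imp (fun h1 z hz => ?_) (fun h1 z hz => ?_)⟩
  · rw [(div_eq_iff hαc).1 (h1 z hz), mul_comm]
  · rw [(div_eq_iff hαc).1 (h1 z hz), mul_comm]

end Linearity

/-! ### Passage to size n, the radius 0, and semidefinite preservers -/

section SignPreservers

open ComplexConjugate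

/-- Truncation of an index to the three values `0`, `1`, `2`. -/
def truncThree (n : ℕ) (i : Fin n) : Fin 3 :=
  ⟨min i 2, by omega⟩

theorem truncThree_castLE {n : ℕ} (hn : 3 ≤ n) (i : Fin 3) :
    truncThree n (Fin.castLE hn i) = i := by
  ext
  simp only [truncThree, Fin.val_castLE]
  omega

theorem submatrix_truncThree_posSemidef_iff {n : ℕ} (hn : 3 ≤ n) (A : Matrix (Fin 3) (Fin 3) ℂ) :
    (A.submatrix (truncThree n) (truncThree n)).PosSemidef ↔ A.PosSemidef := by
  refine ⟨fun h => ?_, fun h => h.submatrix _⟩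
  have := h.submatrix (Fin.castLE hn)
  have hid : truncThree n ∘ Fin.castLE hn = id := funext (truncThree_castLE hn)
  rwa [Matrix.submatrix_submatrix, hid, Matrix.submatrix_id_id] at this

theorem submatrix_add_diagonal_posDef {m k : Type*} [Fintype m] [DecidableEq m]
    {A : Matrix k k ℂ} (hA : A.PosSemidef) (φ : m → k) {d : m → ℝ} (hd : ∀ i, 0 < d i) :
    (A.submatrix φ φ + Matrix.diagonal fun i => (d i : ℂ)).PosDef :=
  Matrix.PosDef.posSemidef_add (hA.submatrix φ)
    (Matrix.PosDef.diagonal fun i => by exact_mod_cast hd i)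

theorem hermThree_apply_mem {I : Set ℝ} {a b c : ℝ} {x y z : ℂ} (ha : ‖(a : ℂ)‖ ∈ I)
    (hb : ‖(b : ℂ)‖ ∈ I) (hc : ‖(c : ℂ)‖ ∈ I) (hx : ‖x‖ ∈ I) (hy : ‖y‖ ∈ I) (hz : ‖z‖ ∈ I)
    (i j : Fin 3) : ‖hermThree a b c x y z i j‖ ∈ I := by
  simp only [Complex.norm_real] at ha hb hc
  fin_cases i <;> fin_cases j <;> simpa [hermThree]

theorem hermThree_apply_self (a b c : ℝ) (x y z : ℂ) (i : Fin 3) :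
    hermThree a b c x y z i i = (![a, b, c] i : ℝ) := by
  fin_cases i <;> simp [hermThree]

theorem hermThree_two_posSemidef (z : ℂ) {r : ℝ} (hr : ‖z‖ ≤ r) :
    (hermThree r r r z z r).PosSemidef := by
  rcases ((norm_nonneg z).trans hr).eq_or_lt with h | h
  · rw [← h, norm_le_zero_iff] at hr
    rw [hr, ← h, Complex.ofReal_zero]
    exact hermThree_zero_posSemidef
  · rwa [hermThree_posSemidef_iff h, schurNonneg_two _ h.le]

theorem smul_posSemidef_iff {m : Type*} {t : ℝ} (ht : 0 < t) (M : Matrix m m ℂ) :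
    ((t : ℂ) • M).PosSemidef ↔ M.PosSemidef := by
  have ht' : (0 : ℂ) < t := by exact_mod_cast ht
  refine ⟨fun h => ?_, fun h => h.smul ht'.le⟩
  have := h.smul (a := ((t⁻¹ : ℝ) : ℂ)) (by exact_mod_cast (inv_pos.2 ht).le)
  rwa [smul_smul, ← Complex.ofReal_mul, inv_mul_cancel₀ ht.ne', Complex.ofReal_one, one_smul] at this

theorem smul_posDef_iff {m : Type*} {t : ℝ} (ht : 0 < t) (M : Matrix m m ℂ) :
    ((t : ℂ) • M).PosDef ↔ M.PosDef := by
  have ht' : (0 : ℂ) < t := by exact_mod_cast ht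
  refine ⟨fun h => ?_, fun h => h.smul ht'⟩
  have := h.smul (a := ((t⁻¹ : ℝ) : ℂ)) (by exact_mod_cast (inv_pos.2 ht))
  rwa [smul_smul, ← Complex.ofReal_mul, inv_mul_cancel₀ ht.ne', Complex.ofReal_one, one_smul] at this

theorem map_eq_smul_or_smul_transpose {m : Type*} {Ω : Set ℂ} {f : Ω → ℂ} {α : ℝ}
    (hf : (∀ z : Ω, f z = α * (z : ℂ)) ∨ (∀ z : Ω, f z = α * conj (z : ℂ)))
    {A : Matrix m m Ω} (hA : (A.map Subtype.val).IsHermitian) :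
    A.map f = (α : ℂ) • A.map Subtype.val ∨ A.map f = (α : ℂ) • (A.map Subtype.val).transpose := by
  refine hf.imp (fun h => ?_) (fun h => ?_)
  · ext i j
    simp [h]
  · ext i j
    have := hA.apply j i
    simp only [Matrix.map_apply] at this
    simp [h, ← this]

theorem isPdSignPreserver_of_linear (n : ℕ) {Ω : Set ℂ} {f : Ω → ℂ} {α : ℝ} (hα : 0 < α)
    (hf : (∀ z : Ω, f z = α * (z : ℂ)) ∨ (∀ z : Ω, f z = α * conj (z : ℂ))) :
    IsPdSignPreserver n f := by
  intro A hA
  rcases map_eq_smul_or_smul_transpose hf hA with h | h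
  · rw [h, smul_posDef_iff hα]
  · rw [h, smul_posDef_iff hα, Matrix.PosDef.transpose_iff]

theorem isPsdSignPreserver_of_linear (n : ℕ) {Ω : Set ℂ} {f : Ω → ℂ} {α : ℝ} (hα : 0 < α)
    (hf : (∀ z : Ω, f z = α * (z : ℂ)) ∨ (∀ z : Ω, f z = α * conj (z : ℂ))) :
    IsPsdSignPreserver n f := by
  intro A hA
  rcases map_eq_smul_or_smul_transpose hf hA with h | h
  · rw [h, smul_posSemidef_iff hα]
  · rw [h, smul_posSemidef_iff hα, Matrix.posSemidef_transpose_iff]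

theorem extend_apply_of_mem {Ω : Set ℂ} (f : Ω → ℂ) (z : Ω) :
    Function.extend Subtype.val f 0 (z : ℂ) = f z :=
  Subtype.val_injective.extend_apply f 0 z

/-- Frees the later arguments from subtypes; the default value 0 outside Ω is never read, as all
entries lie in Ω. -/
theorem IsPdSignPreserver.extend {n : ℕ} {Ω : Set ℂ} {f : Ω → ℂ} (hf : IsPdSignPreserver n f)
    (B : Matrix (Fin n) (Fin n) ℂ) (hB : ∀ i j, B i j ∈ Ω) (hH : B.IsHermitian) :
    B.PosDef ↔ (B.map (Function.extend Subtype.val f 0)).PosDef := by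
  set A : Matrix (Fin n) (Fin n) Ω := Matrix.of fun i j => ⟨B i j, hB i j⟩
  have h1 : A.map Subtype.val = B := rfl
  have h2 : A.map f = B.map (Function.extend Subtype.val f 0) := by
    ext i j
    exact (extend_apply_of_mem f (A i j)).symm
  rw [← h2, ← hf A hH, h1]

theorem IsPsdSignPreserver.extend {n : ℕ} {Ω : Set ℂ} {f : Ω → ℂ} (hf : IsPsdSignPreserver n f)
    (B : Matrix (Fin n) (Fin n) ℂ) (hB : ∀ i j, B i j ∈ Ω) (hH : B.IsHermitian) :
    B.PosSemidef ↔ (B.map (Function.extend Subtype.val f 0)).PosSemidef := by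
  set A : Matrix (Fin n) (Fin n) Ω := Matrix.of fun i j => ⟨B i j, hB i j⟩
  have h1 : A.map Subtype.val = B := rfl
  have h2 : A.map f = B.map (Function.extend Subtype.val f 0) := by
    ext i j
    exact (extend_apply_of_mem f (A i j)).symm
  rw [← h2, ← hf A hH, h1]

/-- The rigidity statement on an interval that may contain `0`. -/
theorem linear_or_conjLinear_with_zero {I : Set ℝ}
    (hI : I.OrdConnected) {r₀ q₀ : ℝ} (hr₀ : r₀ ∈ I) (hq₀ : q₀ ∈ I) (hr0 : 0 < r₀)
    (hrq : r₀ < q₀) {f : ℂ → ℂ}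
    (h : ∀ a ∈ I, 0 < a → ∀ b ∈ I, 0 < b → ∀ c ∈ I, 0 < c → ∀ x y z : ℂ, ‖x‖ ∈ I → ‖y‖ ∈ I →
      ‖z‖ ∈ I →
      ((hermThree a b c x y z).PosSemidef ↔ ((hermThree a b c x y z).map f).PosSemidef))
    (hzero : (0 : ℝ) ∈ I → ∀ q ∈ I, 0 < q → ‖f 0‖ ≤ ‖f q‖) :
    ∃ α : ℝ, 0 < α ∧
      ((∀ z, ‖z‖ ∈ I → f z = α * z) ∨ (∀ z, ‖z‖ ∈ I → f z = α * conj z)) := by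
  obtain ⟨α, hα, hlin⟩ := linear_or_conjLinear_of_posSemidef_iff (I := I ∩ Set.Ioi 0)
    Set.inter_subset_right (hI.inter Set.ordConnected_Ioi) ⟨hr₀, hr0⟩ ⟨hq₀, hr0.trans hrq⟩ hrq
    (f := f) (fun a ha b hb c hc x y z hx hy hz =>
      h a ha.1 ha.2 b hb.1 hb.2 c hc.1 hc.2 x y z hx.1 hy.1 hz.1)
  refine ⟨α, hα, ?_⟩
  have hf0 : (0 : ℝ) ∈ I → f 0 = 0 := by
    intro h0
    have hnorm : ∀ q ∈ I, 0 < q → ‖f q‖ = α * q := by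
      intro q hq hq0
      have hq' : ‖(q : ℂ)‖ ∈ I ∩ Set.Ioi 0 := by
        rw [Complex.norm_real, Real.norm_eq_abs, abs_of_pos hq0]
        exact ⟨hq, hq0⟩
      rcases hlin with h1 | h1 <;> rw [h1 _ hq'] <;> simp [abs_of_pos hq0, abs_of_pos hα]
    by_contra hne
    have hpos : 0 < ‖f 0‖ := norm_pos_iff.2 hne
    have hq0 := hr0.trans hrq
    -- A radius so small that αt ≤ ‖f 0‖/2, contradicting ‖f 0‖ ≤ ‖f t‖ = αt.
    set t := min q₀ (‖f 0‖ / (2 * α)) with ht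
    have ht0 : 0 < t := lt_min hq0 (by positivity)
    have htI : t ∈ I := hI.out h0 hq₀ ⟨ht0.le, min_le_left _ _⟩
    have h1 := hzero h0 t htI ht0
    rw [hnorm t htI ht0] at h1
    have h2 : α * t ≤ α * (‖f 0‖ / (2 * α)) := mul_le_mul_of_nonneg_left (min_le_right _ _) hα.le
    have h3 : α * (‖f 0‖ / (2 * α)) = ‖f 0‖ / 2 := by field_simp
    linarith
  have hcase : ∀ z : ℂ, ‖z‖ ∈ I → (z = 0 ∧ f 0 = 0) ∨ ‖z‖ ∈ I ∩ Set.Ioi 0 := by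
    intro z hz
    rcases eq_or_ne z 0 with rfl | hne
    · left; exact ⟨rfl, hf0 (by simpa using hz)⟩
    · right; exact ⟨hz, norm_pos_iff.2 hne⟩
  refine hlin.imp (fun h1 z hz => ?_) (fun h1 z hz => ?_)
  · rcases hcase z hz with ⟨rfl, h2⟩ | h2
    · simp [h2]
    · exact h1 z h2
  · rcases hcase z hz with ⟨rfl, h2⟩ | h2
    · simp [h2]
    · exact h1 z h2

theorem linear_or_conjLinear_of_psd_preserver {n : ℕ} (hn : 3 ≤ n) {I : Set ℝ}
    (hI0 : I ⊆ Set.Ici 0) (hI : I.OrdConnected) {r₀ q₀ : ℝ} (hr₀ : r₀ ∈ I) (hq₀ : q₀ ∈ I)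
    (hr0 : 0 < r₀) (hrq : r₀ < q₀) {f : ℂ → ℂ}
    (hf : ∀ B : Matrix (Fin n) (Fin n) ℂ, (∀ i j, ‖B i j‖ ∈ I) → B.IsHermitian →
      (B.PosSemidef ↔ (B.map f).PosSemidef)) :
    ∃ α : ℝ, 0 < α ∧
      ((∀ z, ‖z‖ ∈ I → f z = α * z) ∨ (∀ z, ‖z‖ ∈ I → f z = α * conj z)) := by
  have hnormI : ∀ r ∈ I, ‖(r : ℂ)‖ ∈ I := fun r hr => by
    rwa [Complex.norm_real, Real.norm_eq_abs, abs_of_nonneg (hI0 hr)]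
  have h : ∀ a ∈ I, ∀ b ∈ I, ∀ c ∈ I, ∀ x y z : ℂ, ‖x‖ ∈ I → ‖y‖ ∈ I → ‖z‖ ∈ I →
      ((hermThree a b c x y z).PosSemidef ↔ ((hermThree a b c x y z).map f).PosSemidef) := by
    intro a ha b hb c hc x y z hx hy hz
    rw [← submatrix_truncThree_posSemidef_iff hn, ← submatrix_truncThree_posSemidef_iff hn,
      hf ((hermThree a b c x y z).submatrix _ _) (fun i j => hermThree_apply_mem (hnormI a ha) (hnormI b hb) (hnormI c hc) hx hy hz _ _)
        ((hermThree_isHermitian a b c x y z).submatrix _)]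
    rfl
  refine linear_or_conjLinear_with_zero hI hr₀ hq₀ hr0 hrq
    (fun a ha _ b hb _ c hc _ => h a ha b hb c hc) ?_
  intro h0 q hq hq0
  have hz : ‖(0 : ℂ)‖ ∈ I := by simpa using h0
  have h1 := (h q hq q hq q hq 0 0 q hz hz (hnormI q hq)).1
    (hermThree_two_posSemidef 0 (by simpa using hq0.le))
  have h2 := h1.normSq_apply_le 0 1
  have h3 : Complex.normSq (f 0) ≤ (f q).re * (f q).re := by simpa [hermThree] using h2
  rw [Complex.normSq_eq_norm_sq, ← sq] at h3
  have h4 := sq_le_sq.1 h3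
  rw [abs_of_nonneg (norm_nonneg _)] at h4
  exact h4.trans (Complex.abs_re_le_norm _)

end SignPreservers

/-! ### Definite preservers -/

section PositiveDefinite

open ComplexConjugate

theorem truncThree_eq_zero_iff {n : ℕ} (i : Fin n) : truncThree n i = 0 ↔ (i : ℕ) = 0 := by
  rw [Fin.ext_iff]
  simp only [truncThree, Fin.val_zero]
  omega

theorem posDef_map_submatrix_castLE {n : ℕ} (hn : 3 ≤ n) {B : Matrix (Fin n) (Fin n) ℂ}
    {f : ℂ → ℂ} (h : (B.map f).PosDef) :
    ((B.submatrix (Fin.castLE hn) (Fin.castLE hn)).map f).PosDef :=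
  h.submatrix (Fin.castLE_injective hn)

theorem perturb_submatrix_castLE {n : ℕ} (hn : 3 ≤ n) (A : Matrix (Fin 3) (Fin 3) ℂ)
    (d : Fin n → ℝ) :
    (A.submatrix (truncThree n) (truncThree n) + Matrix.diagonal fun i => (d i : ℂ)).submatrix
      (Fin.castLE hn) (Fin.castLE hn) =
    A + Matrix.diagonal fun i => (d (Fin.castLE hn i) : ℂ) := by
  ext i j
  simp [truncThree_castLE, Matrix.diagonal_apply]

theorem hermThree_add_diagonal (a b c : ℝ) (x y z : ℂ) (d : Fin 3 → ℝ) :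
    (hermThree a b c x y z + Matrix.diagonal fun i => (d i : ℂ)) =
      hermThree (a + d 0) (b + d 1) (c + d 2) x y z := by
  ext i j
  fin_cases i <;> fin_cases j <;> simp [hermThree]

variable {n : ℕ} {I : Set ℝ} {f : ℂ → ℂ}

theorem perturb_map_posDef (hn : 3 ≤ n)
    (hf : ∀ B : Matrix (Fin n) (Fin n) ℂ, (∀ i j, ‖B i j‖ ∈ I) → B.IsHermitian →
      (B.PosDef ↔ (B.map f).PosDef)) {a b c : ℝ} {x y z : ℂ}
    (hA : (hermThree a b c x y z).PosSemidef) {d : Fin n → ℝ} (hd : ∀ i, 0 < d i)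
    (hB : ∀ i j, ‖(((hermThree a b c x y z).submatrix (truncThree n) (truncThree n) +
      Matrix.diagonal fun i => (d i : ℂ) : Matrix (Fin n) (Fin n) ℂ)) i j‖ ∈ I) :
    ((hermThree (a + d (Fin.castLE hn 0)) (b + d (Fin.castLE hn 1)) (c + d (Fin.castLE hn 2))
      x y z).map f).PosDef := by
  have h1 := submatrix_add_diagonal_posDef hA (truncThree n) hd
  have h2 := posDef_map_submatrix_castLE hn ((hf _ hB h1.1).1 h1)
  rwa [perturb_submatrix_castLE, hermThree_add_diagonal a b c x y z
    (fun i => d (Fin.castLE hn i))] at h2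

theorem perturb_apply_norm_mem {A : Matrix (Fin 3) (Fin 3) ℂ} {d : Fin n → ℝ}
    (hoff : ∀ i j, i ≠ j → ‖A (truncThree n i) (truncThree n j)‖ ∈ I)
    (hdiag : ∀ i, ‖A (truncThree n i) (truncThree n i) + d i‖ ∈ I) (i j : Fin n) :
    ‖(A.submatrix (truncThree n) (truncThree n) +
      Matrix.diagonal fun i => (d i : ℂ) : Matrix (Fin n) (Fin n) ℂ) i j‖ ∈ I := by
  rcases eq_or_ne i j with rfl | hij
  · simpa using hdiag i
  · simpa [hij] using hoff i j hij

/-- Raising the diagonal of a singular matrix from ‖z‖ to q makes it definite; the image's Hermitian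
symmetry, diagonal and 2 × 2 minor give the three claims. -/
theorem pd_preserver_two (hn : 3 ≤ n) (hI0 : I ⊆ Set.Ici 0)
    (hf : ∀ B : Matrix (Fin n) (Fin n) ℂ, (∀ i j, ‖B i j‖ ∈ I) → B.IsHermitian →
      (B.PosDef ↔ (B.map f).PosDef)) {z : ℂ} {q : ℝ} (hz : ‖z‖ ∈ I) (hq : q ∈ I) (hzq : ‖z‖ < q) :
    f (conj z) = conj (f z) ∧ f q = (f q).re ∧ ‖f z‖ < (f q).re := by
  have hd : 0 < q - ‖z‖ := sub_pos.2 hzq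
  have hnz : ‖((‖z‖ : ℝ) : ℂ)‖ ∈ I := by rwa [Complex.norm_real, norm_norm]
  have h1 := perturb_map_posDef hn hf (hermThree_two_posSemidef z le_rfl)
    (d := fun _ => q - ‖z‖) (fun _ => hd)
    (perturb_apply_norm_mem (fun i j _ => hermThree_apply_mem hnz hnz hnz hz hz hnz _ _) (by
      intro i
      rw [hermThree_apply_self]
      have : ∀ k : Fin 3, (![‖z‖, ‖z‖, ‖z‖] k : ℝ) = ‖z‖ := by
        intro k; fin_cases k <;> rfl
      rw [this, ← Complex.ofReal_add, add_sub_cancel, Complex.norm_real, Real.norm_eq_abs,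
        abs_of_nonneg (hI0 hq)]
      exact hq))
  simp only [add_sub_cancel] at h1
  have hconj : f (conj z) = conj (f z) := by
    simpa [hermThree] using (h1.1.apply 1 0).symm
  have hdiag : 0 < f q := by simpa [hermThree] using h1.diag_pos (i := 0)
  obtain ⟨hre, him⟩ := Complex.lt_def.1 hdiag
  have hlt := h1.normSq_apply_lt (i := 0) (j := 1) (by decide)
  have hlt' : Complex.normSq (f z) < (f q).re * (f q).re := by simpa [hermThree] using hlt
  rw [Complex.normSq_eq_norm_sq, ← sq] at hlt'
  exact ⟨hconj, Complex.ext rfl (by simpa using him.symm),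
    lt_of_pow_lt_pow_left₀ 2 hre.le hlt'⟩

/-- Serves right-continuity: c exceeds p, yet c² < pd with d < q leaves room to raise a semidefinite
matrix to diagonal p, q, q. -/
theorem pd_preserver_geometric (hn : 3 ≤ n) (hI : I.OrdConnected)
    (hf : ∀ B : Matrix (Fin n) (Fin n) ℂ, (∀ i j, ‖B i j‖ ∈ I) → B.IsHermitian →
      (B.PosDef ↔ (B.map f).PosDef)) {p q : ℝ} (hp : p ∈ I) (hq : q ∈ I) (hp0 : 0 < p)
    (hpq : p < q) :
    ∃ c ∈ I, p < c ∧ ‖f c‖ ^ 2 < (f p).re * (f q).re := by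
  set d := (p + q) / 2 with hd
  have hpd : p < d := by linarith
  have hdq : d < q := by linarith
  have hd0 := hp0.trans hpd
  obtain ⟨c, hpc, hcd⟩ := exists_between (Real.lt_sqrt_of_sq_lt (show p ^ 2 < p * d by nlinarith))
  have hc0 := hp0.trans hpc
  have hc2 : c ^ 2 < p * d := (Real.lt_sqrt hc0.le).1 hcd
  have hcd' : c < d := by nlinarith
  have hIn : ∀ t, p ≤ t → t ≤ q → ‖(t : ℂ)‖ ∈ I := fun t h1 h2 => by
    rw [Complex.norm_real, Real.norm_eq_abs, abs_of_pos (hp0.trans_le h1)]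
    exact hI.out hp hq ⟨h1, h2⟩
  have hpsd : (hermThree (c ^ 2 / d) d d c c d).PosSemidef := by
    rw [hermThree_posSemidef_iff hd0]
    have : (d : ℂ) * c - c * conj (d : ℂ) = 0 := by rw [Complex.conj_ofReal]; ring
    rw [SchurNonneg, this]
    refine ⟨?_, ?_, ?_⟩
    · rw [Complex.normSq_ofReal]; field_simp; rfl
    · rw [Complex.normSq_ofReal]
    · rw [Complex.normSq_ofReal d]; simp
  have hsm : c ^ 2 / d < p := by rwa [div_lt_iff₀ hd0]
  have hne : ∀ i : Fin n, (i : ℕ) ≠ 0 → truncThree n i = 1 ∨ truncThree n i = 2 := by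
    intro i hi
    have h1 := (truncThree_eq_zero_iff i).not.2 hi
    revert h1
    generalize truncThree n i = k
    fin_cases k <;> simp
  have h1 := perturb_map_posDef hn hf hpsd
    -- c²/d may lie outside I, but index 0 is not repeated in the blow-up, so that entry occurs only
    -- on the diagonal, where it becomes p.
    (d := fun i => if (i : ℕ) = 0 then p - c ^ 2 / d else q - d)
    (fun i => by split_ifs <;> linarith)
    (perturb_apply_norm_mem (by
      intro i j hij
      have hc := hIn c hpc.le (hcd'.trans hdq).le
      have hdI := hIn d hpd.le hdq.le
      by_cases hi : (i : ℕ) = 0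
      · have hj : (j : ℕ) ≠ 0 := fun hj => hij (Fin.ext (hi.trans hj.symm))
        rw [(truncThree_eq_zero_iff i).2 hi]
        rcases hne j hj with h | h <;> rw [h] <;> simpa [hermThree] using hc
      · by_cases hj : (j : ℕ) = 0
        · rw [(truncThree_eq_zero_iff j).2 hj]
          rcases hne i hi with h | h <;> rw [h] <;> simpa [hermThree] using hc
        · rcases hne i hi with h | h <;> rcases hne j hj with h' | h' <;> rw [h, h'] <;>
            simpa [hermThree] using hdI) (by
      intro i
      by_cases hi : (i : ℕ) = 0
      · rw [(truncThree_eq_zero_iff i).2 hi, hermThree_apply_self, if_pos hi,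
          ← Complex.ofReal_add]
        simp only [Matrix.cons_val_zero, add_sub_cancel]
        exact hIn p le_rfl hpq.le
      · rw [if_neg hi]
        have : hermThree (c ^ 2 / d) d d c c d (truncThree n i) (truncThree n i) = d := by
          rcases hne i hi with h | h <;> rw [h] <;> simp [hermThree]
        rw [this, ← Complex.ofReal_add, add_sub_cancel]
        exact hIn q hpq.le le_rfl))
  have h2 := h1.normSq_apply_lt (i := 0) (j := 1) (by decide)
  refine ⟨c, hI.out hp hq ⟨hpc.le, (hcd'.trans hdq).le⟩, hpc, ?_⟩
  rw [← Complex.normSq_eq_norm_sq]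
  have e1 : c ^ 2 / d + (p - c ^ 2 / d) = p := by ring
  have e2 : d + (q - d) = q := by ring
  simp only [Fin.val_castLE, Fin.val_zero, Fin.val_one, if_true, one_ne_zero, if_false, e1, e2]
    at h2
  simpa [hermThree] using h2

theorem linear_or_conjLinear_of_pd_preserver (hn : 3 ≤ n)
    (hI0 : I ⊆ Set.Ici 0) (hI : I.OrdConnected) {r₀ q₀ : ℝ} (hr₀ : r₀ ∈ I) (hq₀ : q₀ ∈ I)
    (hr0 : 0 < r₀) (hrq : r₀ < q₀) (hopen : ∀ r ∈ I, ∃ e, 0 < e ∧ r + e ∈ I)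
    (hf : ∀ B : Matrix (Fin n) (Fin n) ℂ, (∀ i j, ‖B i j‖ ∈ I) → B.IsHermitian →
      (B.PosDef ↔ (B.map f).PosDef)) :
    ∃ α : ℝ, 0 < α ∧
      ((∀ z, ‖z‖ ∈ I → f z = α * z) ∨ (∀ z, ‖z‖ ∈ I → f z = α * conj z)) := by
  have hnorm : ∀ r ∈ I, ‖(r : ℂ)‖ = r := fun r hr => by
    rw [Complex.norm_real, Real.norm_eq_abs, abs_of_nonneg (hI0 hr)]
  have hnormI : ∀ r ∈ I, ‖(r : ℂ)‖ ∈ I := fun r hr => by rwa [hnorm r hr]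
  have hconj : ∀ z : ℂ, ‖z‖ ∈ I → f (conj z) = conj (f z) := by
    intro z hz
    obtain ⟨e, he, heI⟩ := hopen _ hz
    exact (pd_preserver_two hn hI0 hf hz heI (by linarith)).1
  set g : ℝ → ℝ := fun r => (f r).re with hg
  have hfg : ∀ r ∈ I, f r = g r := by
    intro r hr
    have := hconj r (hnormI r hr)
    rw [Complex.conj_ofReal] at this
    exact (Complex.conj_eq_iff_re.1 this.symm).symm
  have hnormlt : ∀ z : ℂ, ‖z‖ ∈ I → ∀ q ∈ I, ‖z‖ < q → ‖f z‖ < g q := fun z hz q hq hzq =>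
    (pd_preserver_two hn hI0 hf hz hq hzq).2.2
  have hmono : ∀ r ∈ I, ∀ q ∈ I, r < q → g r < g q := by
    intro r hr q hq hrq
    exact (Complex.re_le_norm _).trans_lt
      (hnormlt r (hnormI r hr) q hq (by rwa [hnorm r hr]))
  -- If the infimum L of `g` to the right of p exceeded `g p`, the geometric bound would give L² ≤
  -- g(p) · s for each value s there, hence L ≤ g(p).
  have hright : ∀ p ∈ I, 0 < p → ∀ η, 0 < η → ∃ q ∈ I, p < q ∧ g q < g p + η := by
    intro p hp hp0 η hη
    by_contra! hno
    set S := g '' (I ∩ Set.Ioi p) with hS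
    obtain ⟨e, he, heI⟩ := hopen p hp
    have hSne : S.Nonempty := ⟨g (p + e), p + e, ⟨heI, by simpa using he⟩, rfl⟩
    have hlb : ∀ s ∈ S, g p + η ≤ s := by
      rintro _ ⟨q, ⟨hq, hpq⟩, rfl⟩
      exact hno q hq hpq
    have hbdd : BddBelow S := ⟨_, hlb⟩
    have hL := le_csInf hSne hlb
    set L := sInf S with hLdef
    have hLnonneg : 0 ≤ L := by
      apply le_csInf hSne
      rintro _ ⟨q, ⟨hq, hpq⟩, rfl⟩
      exact (norm_nonneg _).trans (hnormlt p (hnormI p hp) q hq (by rwa [hnorm p hp])).le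
    have hsq : ∀ s ∈ S, L ^ 2 < g p * s := by
      rintro _ ⟨q, ⟨hq, hpq⟩, rfl⟩
      obtain ⟨c, hc, hpc, hlt⟩ := pd_preserver_geometric hn hI hf hp hq hp0 hpq
      have h1 : L ≤ ‖f c‖ := (csInf_le hbdd ⟨c, ⟨hc, hpc⟩, rfl⟩).trans (Complex.re_le_norm _)
      exact (pow_le_pow_left₀ hLnonneg h1 2).trans_lt hlt
    have hgp : 0 < g p := by
      obtain ⟨s, hs⟩ := hSne
      have h1 : 0 < g p * s := (sq_nonneg L).trans_lt (hsq s hs)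
      exact pos_of_mul_pos_left h1 (hLnonneg.trans (csInf_le hbdd hs))
    have h2 : L ^ 2 / g p ≤ L := by
      apply le_csInf hSne
      intro s hs
      rw [div_le_iff₀ hgp]
      linarith [hsq s hs]
    rw [div_le_iff₀ hgp] at h2
    nlinarith
  have hmap : ∀ a ∈ I, ∀ b ∈ I, ∀ c ∈ I, ∀ x y z : ℂ, ‖x‖ ∈ I → ‖y‖ ∈ I → ‖z‖ ∈ I →
      (hermThree a b c x y z).map f = hermThree (g a) (g b) (g c) (f x) (f y) (f z) :=
    fun a ha b hb c hc x y z hx hy hz => hermThree_map (hfg a ha) (hfg b hb) (hfg c hc)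
      (hconj x hx) (hconj y hy) (hconj z hz)
  refine linear_or_conjLinear_with_zero hI hr₀ hq₀ hr0 hrq ?_ ?_
  · intro a ha ha0 b hb hb0 c hc hc0 x y z hx hy hz
    obtain ⟨e₀, he₀, hea, heb, hec⟩ : ∃ e₀, 0 < e₀ ∧ a + e₀ ∈ I ∧ b + e₀ ∈ I ∧ c + e₀ ∈ I := by
      obtain ⟨e₁, h₁, h₁'⟩ := hopen a ha
      obtain ⟨e₂, h₂, h₂'⟩ := hopen b hb
      obtain ⟨e₃, h₃, h₃'⟩ := hopen c hc
      have hm : 0 < min e₁ (min e₂ e₃) := lt_min h₁ (lt_min h₂ h₃)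
      have m1 : min e₁ (min e₂ e₃) ≤ e₁ := min_le_left _ _
      have m2 : min e₁ (min e₂ e₃) ≤ e₂ := (min_le_right _ _).trans (min_le_left _ _)
      have m3 : min e₁ (min e₂ e₃) ≤ e₃ := (min_le_right _ _).trans (min_le_right _ _)
      exact ⟨_, hm, hI.out ha h₁' ⟨by linarith, by linarith⟩,
        hI.out hb h₂' ⟨by linarith, by linarith⟩, hI.out hc h₃' ⟨by linarith, by linarith⟩⟩
    have hmem : ∀ k : Fin 3, (![a, b, c] k : ℝ) ∈ I := by
      intro k; fin_cases k <;> assumption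
    have hmem₀ : ∀ k : Fin 3, (![a, b, c] k : ℝ) + e₀ ∈ I := by
      intro k; fin_cases k <;> assumption
    have hmeme : ∀ e, 0 < e → e ≤ e₀ → ∀ k : Fin 3, (![a, b, c] k : ℝ) + e ∈ I :=
      fun e he hle k => hI.out (hmem k) (hmem₀ k) ⟨by linarith, by linarith⟩
    have hBI : ∀ e, 0 < e → e ≤ e₀ → ∀ i j : Fin n,
        ‖((hermThree a b c x y z).submatrix (truncThree n) (truncThree n) +
          Matrix.diagonal fun _ => ((e : ℝ) : ℂ) : Matrix (Fin n) (Fin n) ℂ) i j‖ ∈ I := by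
      intro e he hle
      refine perturb_apply_norm_mem (d := fun _ => e) (fun i j _ => hermThree_apply_mem
        (hnormI a ha) (hnormI b hb) (hnormI c hc) hx hy hz _ _) (fun i => ?_)
      rw [hermThree_apply_self, ← Complex.ofReal_add]
      exact hnormI _ (hmeme e he hle _)
    constructor
    -- A + e is definite, so its image is too; right-continuity bounds the image's diagonal by that
    -- of f[A] + η, and η tends to 0.
    · intro hA
      rw [hmap a ha b hb c hc x y z hx hy hz]
      refine hermThree_posSemidef_of_forall_add one_pos fun η hη _ => ?_
      have hstep : ∀ p ∈ I, 0 < p → ∃ e, 0 < e ∧ ∀ e', 0 < e' → e' ≤ e → p + e' ∈ I →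
          g (p + e') ≤ g p + η := by
        intro p hp hp0
        obtain ⟨q, hq, hpq, hgq⟩ := hright p hp hp0 η hη
        refine ⟨q - p, sub_pos.2 hpq, fun e' _ hle heI => ?_⟩
        rcases (show p + e' ≤ q by linarith).eq_or_lt with h1 | h1
        · rw [h1]; exact hgq.le
        · exact ((hmono _ heI q hq h1).trans hgq).le
      obtain ⟨e₁, h₁, h₁'⟩ := hstep a ha ha0
      obtain ⟨e₂, h₂, h₂'⟩ := hstep b hb hb0
      obtain ⟨e₃, h₃, h₃'⟩ := hstep c hc hc0
      set e := min e₀ (min e₁ (min e₂ e₃)) with hedef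
      have he : 0 < e := lt_min he₀ (lt_min h₁ (lt_min h₂ h₃))
      have m0 : e ≤ e₀ := min_le_left _ _
      have m1 : e ≤ e₁ := (min_le_right _ _).trans (min_le_left _ _)
      have m2 : e ≤ e₂ := (min_le_right _ _).trans ((min_le_right _ _).trans (min_le_left _ _))
      have m3 : e ≤ e₃ := (min_le_right _ _).trans ((min_le_right _ _).trans (min_le_right _ _))
      have hae := hmeme e he m0 0
      have hbe := hmeme e he m0 1
      have hce := hmeme e he m0 2
      simp only [Matrix.cons_val] at hae hbe hce
      have h1 := (perturb_map_posDef hn hf hA (d := fun _ => e) (fun _ => he)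
        (hBI e he m0)).posSemidef
      rw [hmap _ hae _ hbe _ hce x y z hx hy hz] at h1
      exact hermThree_diag_add_posSemidef h1 (h₁' e he m1 hae) (h₂' e he m2 hbe) (h₃' e he m3 hce)
    · intro hA
      refine hermThree_posSemidef_of_forall_add he₀ fun e he hle => ?_
      -- By strict monotonicity, f[A + e] is f[A] plus a positive diagonal, hence definite.
      have h1 := submatrix_add_diagonal_posDef hA (truncThree n)
        (d := fun i => g (![a, b, c] (truncThree n i) + e) - g (![a, b, c] (truncThree n i)))
        (fun i => sub_pos.2 (hmono _ (hmem _) _ (hmeme e he hle _) (by linarith)))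
      have h2 : ((hermThree a b c x y z).submatrix (truncThree n) (truncThree n) +
          Matrix.diagonal fun _ => ((e : ℝ) : ℂ) : Matrix (Fin n) (Fin n) ℂ).map f =
          ((hermThree a b c x y z).map f).submatrix (truncThree n) (truncThree n) +
          Matrix.diagonal fun i => ((g (![a, b, c] (truncThree n i) + e)
            - g (![a, b, c] (truncThree n i)) : ℝ) : ℂ) := by
        ext i j
        rcases eq_or_ne i j with rfl | hij
        · simp only [Matrix.map_apply, Matrix.add_apply, Matrix.submatrix_apply,
            Matrix.diagonal_apply_eq, hermThree_apply_self]
          rw [← Complex.ofReal_add, hfg _ (hmeme e he hle _), hfg _ (hmem _), ← Complex.ofReal_add,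
            add_sub_cancel]
        · simp [hij]
      rw [← h2] at h1
      have hherm : ((hermThree a b c x y z).submatrix (truncThree n) (truncThree n) +
          Matrix.diagonal fun _ => ((e : ℝ) : ℂ) : Matrix (Fin n) (Fin n) ℂ).IsHermitian :=
        ((hermThree_isHermitian a b c x y z).submatrix _).add
          (Matrix.isHermitian_diagonal_of_self_adjoint _ (funext fun _ => Complex.conj_ofReal e))
      have h3 := (((hf _ (hBI e he hle) hherm).2 h1).posSemidef).submatrix (Fin.castLE hn)
      rwa [perturb_submatrix_castLE hn _ (fun _ => e),
        hermThree_add_diagonal a b c x y z (fun _ => e)] at h3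
  · intro h0 q hq hq0
    have := hnormlt 0 (by simpa using h0) q hq (by simpa using hq0)
    exact this.le.trans (Complex.re_le_norm _)

end PositiveDefinite

/-! ### The theorem -/

theorem theoremC (n : ℕ) (hn : 3 ≤ n) (Ω : Set ℂ) (hΩ : IsAnnulus Ω) (hΩ0 : Ω ≠ {0})
    (f : Ω → ℂ) :
    (IsPdType Ω →
      (IsPdSignPreserver n f ↔
        ∃ α : ℝ, 0 < α ∧ ((∀ z : Ω, f z = (α : ℂ) * (z : ℂ)) ∨
          (∀ z : Ω, f z = (α : ℂ) * (starRingEnd ℂ) (z : ℂ))))) ∧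
    (IsPsdType Ω →
      (IsPsdSignPreserver n f ↔
        ∃ α : ℝ, 0 < α ∧ ((∀ z : Ω, f z = (α : ℂ) * (z : ℂ)) ∨
          (∀ z : Ω, f z = (α : ℂ) * (starRingEnd ℂ) (z : ℂ))))) := by
  obtain ⟨I, hI0, hI, hΩI⟩ := hΩ
  have hΩmem : ∀ z, z ∈ Ω ↔ ‖z‖ ∈ I := fun z => by rw [hΩI]; rfl
  have hmem : ∀ r : ℝ, r ∈ nonnegPart Ω ↔ r ∈ I := by
    intro r
    constructor
    · rintro ⟨h0, h1⟩
      rwa [hΩmem, Complex.norm_real, Real.norm_eq_abs, abs_of_nonneg h0] at h1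
    · intro hr
      refine ⟨hI0 hr, ?_⟩
      rwa [hΩmem, Complex.norm_real, Real.norm_eq_abs, abs_of_nonneg (hI0 hr)]
  -- The point -r lets the type condition be applied at any positive radius r.
  have hneg : ∀ r ∈ I, 0 < r → (-(r : ℂ)) ∈ Ω \ (fun r : ℝ => (r : ℂ)) '' nonnegPart Ω := by
    intro r hr hr0
    refine ⟨?_, ?_⟩
    · rwa [hΩmem, norm_neg, Complex.norm_real, Real.norm_eq_abs, abs_of_pos hr0]
    · rintro ⟨s, hs, hs'⟩
      have : s = -r := Complex.ofReal_injective (hs'.trans (Complex.ofReal_neg r).symm)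
      linarith [hs.1]
  have hnneg : ∀ r : ℝ, 0 < r → ‖-(r : ℂ)‖ = r := fun r hr0 => by
    rw [norm_neg, Complex.norm_real, Real.norm_eq_abs, abs_of_pos hr0]
  have hcase : IsEmpty Ω ∨ ∃ r ∈ I, 0 < r := by
    rw [or_iff_not_imp_left, not_isEmpty_iff]
    rintro ⟨w, hw⟩
    by_contra! hno
    have hzero : ∀ v ∈ Ω, v = 0 := fun v hv => norm_le_zero_iff.1 (hno _ ((hΩmem v).1 hv))
    refine hΩ0 (Set.eq_singleton_iff_unique_mem.2 ⟨?_, hzero⟩)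
    rwa [← hzero w hw]
  have hfinish : (∃ α : ℝ, 0 < α ∧
      ((∀ z, ‖z‖ ∈ I → Function.extend Subtype.val f 0 z = α * z) ∨
        (∀ z, ‖z‖ ∈ I → Function.extend Subtype.val f 0 z = α * (starRingEnd ℂ) z))) →
      ∃ α : ℝ, 0 < α ∧ ((∀ z : Ω, f z = (α : ℂ) * (z : ℂ)) ∨
          (∀ z : Ω, f z = (α : ℂ) * (starRingEnd ℂ) (z : ℂ))) := by
    rintro ⟨α, hα, h⟩
    refine ⟨α, hα, h.imp (fun h z => ?_) (fun h z => ?_)⟩ <;>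
      rw [← extend_apply_of_mem f z] <;> exact h z ((hΩmem z).1 z.2)
  refine ⟨fun hpd => ⟨fun hf => ?_, ?_⟩, fun hpsd => ⟨fun hf => ?_, ?_⟩⟩
  · rcases hcase with hemp | ⟨r, hr, hr0⟩
    · exact ⟨1, one_pos, Or.inl fun z => hemp.elim z⟩
    have hstep : ∀ r ∈ I, 0 < r → ∃ e, 0 < e ∧ r + e ∈ I := by
      intro r hr hr0
      obtain ⟨e, he, h1⟩ := hpd _ (hneg r hr hr0)
      rw [hmem, hnneg r hr0] at h1
      exact ⟨e, he, h1⟩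
    obtain ⟨e, he, heI⟩ := hstep r hr hr0
    refine hfinish (linear_or_conjLinear_of_pd_preserver hn hI0 hI hr heI hr0 (by linarith) ?_
      fun B hB => hf.extend B fun i j => (hΩmem _).2 (hB i j))
    intro s hs
    rcases (Set.mem_Ici.1 (hI0 hs)).eq_or_lt with h0 | h0
    · exact ⟨r, hr0, by rwa [← h0, zero_add]⟩
    · exact hstep s hs h0
  · rintro ⟨α, hα, h⟩
    exact isPdSignPreserver_of_linear n hα h
  · rcases hcase with hemp | ⟨r, hr, hr0⟩
    · exact ⟨1, one_pos, Or.inl fun z => hemp.elim z⟩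
    obtain ⟨δ, hδ, h1⟩ := hpsd _ (hneg r hr hr0)
    rw [hmem, hnneg r hr0] at h1
    have h0 : (0 : ℝ) ≤ r - δ := hI0 h1
    -- The radius r - δ may be 0, so the halfway point r - δ/2 serves as the smaller positive
    -- radius.
    exact hfinish (linear_or_conjLinear_of_psd_preserver hn hI0 hI
      (hI.out h1 hr (show r - δ / 2 ∈ Set.Icc (r - δ) r from ⟨by linarith, by linarith⟩)) hr
      (by linarith) (by linarith) fun B hB => hf.extend B fun i j => (hΩmem _).2 (hB i j))
  · rintro ⟨α, hα, h⟩
    exact isPsdSignPreserver_of_linear n hα h
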